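/- Let $y_0>0$ and $C>0$. Consider the degenerate equation $$-\big((1-f^2)f'''\big)'+\tfrac14\,y f'=0,\qquad f\in(-1,1), \qquad (1)$$ and call $f$ a *local free-boundary solution* if, for some $\delta>0$, $f$ is a classical solution of (1) on $(y_0-\delta,y_0)$ ($f\in C^3$ and $(1-f^2)f'''$ is differentiable there) and $$f(y)=1-C(y_0-y)^2+O\big((y_0-y)^3\big)\quad\text{as } y\to y_0^-. \qquad (2)$$ Then a local free-boundary solution exists and any two coincide on some interval $(y_0-\delta',y_0)$ with $\delta'>0$; the solution can be taken, for $\delta$ small, strictly increasing on $(y_0-\delta,y_0)$, and it satisfies $f'(y)\to0$, $\big((1-f^2)f'''\big)(y)\to0$ and $f(y)=1-C(y_0-y)^2+\frac{y_0}{48}(y_0-y)^3+O\big((y_0-y)^4\big)$ as $y\to y_0^-$. Moreover, the solution is real analytic at the degeneracy point $y=y_0$: for every local free-boundary solution $f$ there is a function $F$, real analytic in a neighbourhood of $y_0$, with $f=F$ on some interval $(y_0-\delta',y_0)$, $\delta'>0$. -/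

import Mathlib

open Set Filter Topology Asymptotics

/-- The flux `(1 - f²) f'''`. -/
noncomputable def thinFilmFlux (f : ℝ → ℝ) (y : ℝ) : ℝ :=
  (1 - f y ^ 2) * iteratedDeriv 3 f y

/-- `f` is a classical solution, with values in the proper range `(-1, 1)`, of the equation
`-((1 - f²) f''')' + (1/4) y f' = 0` on the interval `(a, b)`. Values of `f` outside `(a, b)` are
irrelevant. The equation is in divergence form: `f` is `C³` and the flux is differentiable. -/
structure IsThinFilmProfileOn (f : ℝ → ℝ) (a b : ℝ) : Prop where
  contDiffOn : ContDiffOn ℝ 3 f (Ioo a b)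
  mem_range : ∀ y ∈ Ioo a b, f y ∈ Ioo (-1 : ℝ) 1
  differentiable_flux : ∀ y ∈ Ioo a b, DifferentiableAt ℝ (thinFilmFlux f) y
  equation : ∀ y ∈ Ioo a b, -deriv (thinFilmFlux f) y + 1 / 4 * y * deriv f y = 0

/-- `f` is a local solution on `(y₀ - δ, y₀)` that degenerates at the free-boundary point `y₀`
with `f(y) = 1 - C (y₀ - y)² + O((y₀ - y)³)` as `y → y₀⁻`. -/
structure IsLocalFBSolution (y₀ C δ : ℝ) (f : ℝ → ℝ) : Prop where
  pos : 0 < δ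
  solution : IsThinFilmProfileOn f (y₀ - δ) y₀
  expansion : (fun y => f y - (1 - C * (y₀ - y) ^ 2)) =O[𝓝[<] y₀] fun y => (y₀ - y) ^ 3

/-! Put `t = y₀ - y` and `g = 1 - f`. Then `1 - f² = g (2 - g)` and the equation reads `(g (2 - g)
g''')' = -(y₀ - t) g' / 4`. If the flux vanishes at `t = 0`, one integration gives `g (2 - g) g''' =
-((y₀ - t) g + ∫₀ᵗ g) / 4`. Both sides vanish to order `t²`. With `g = t² u` and `u` close to `C >
0`, division by `t² u (2 - t² u)` leaves a regular formula for `w = g'''` in terms of `u`;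
conversely `u` is `C` plus `t` times an iterated average of `w`. The degenerate problem becomes a
fixed-point equation for `w`, and the factor `t` makes it a contraction for small radius
(`norm_profileMap_sub_le`).

All integrals are averages along rays, so one set of estimates serves two domains. On a complex
disc, the iterates of the operator converge to a holomorphic fixed point that is real on the real
axis (`exists_profileMap_fixedPoint`); this gives existence and analyticity. On the real segment
`(0, r)`, where nothing is assumed at `0`, fixed points are unique; every local solution yields one
(`profileMap_fixedPoint_of_solution`), so it is the restriction of the holomorphic one.

The expansion of a given solution keeps `u` near `C` and fixes the constants of integration. The
delicate one is the flux constant: a third difference of `g` gives points tending to `0` at which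
`g'''` is bounded, so the constant is zero (`flux_integral_eq_zero`). -/

/-! ### Averages along rays. -/

/-- `∫₀¹ sᵏ w(s z) ds`. -/
noncomputable def radialMoment (k : ℕ) (w : ℂ → ℂ) (z : ℂ) : ℂ :=
  ∫ s in (0 : ℝ)..1, (s : ℂ) ^ k * w (s * z)

/-- `S` is stable under multiplication by scalars in `(0, 1]`. -/
def IsRadial (S : Set ℂ) : Prop :=
  ∀ z ∈ S, ∀ s ∈ Ioc (0 : ℝ) 1, (s : ℂ) * z ∈ S

/-- `w` is continuous on `S` and bounded there by `M`. -/
structure ContBoundedOn (S : Set ℂ) (M : ℝ) (w : ℂ → ℂ) : Prop where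
  cont : ContinuousOn w S
  bound : ∀ z ∈ S, ‖w z‖ ≤ M

theorem isRadial_ball (r : ℝ) : IsRadial (Metric.ball (0 : ℂ) r) := by
  intro z hz s hs
  simp only [mem_ball_zero_iff, norm_mul, Complex.norm_real, Real.norm_eq_abs] at hz ⊢
  rw [abs_of_pos hs.1]
  nlinarith [hs.1, hs.2, norm_nonneg z]

/-- This is why the scalar `0` is excluded from the scalings: a given solution is not known to
extend to `t = 0`. -/
theorem isRadial_segment (r : ℝ) : IsRadial (Complex.ofReal '' Ioo 0 r) := by
  rintro _ ⟨t, ht, rfl⟩ s hs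
  refine ⟨s * t, ⟨mul_pos hs.1 ht.1, ?_⟩, by push_cast; rfl⟩
  nlinarith [hs.1, hs.2, ht.1, ht.2]

section
variable {S : Set ℂ} {M D : ℝ} {w w₁ w₂ : ℂ → ℂ}

theorem norm_pow_mul_le_of_mem_Ioc {s : ℝ} (hs : s ∈ Ioc (0 : ℝ) 1) (k : ℕ) (a : ℂ) :
    ‖(s : ℂ) ^ k * a‖ ≤ ‖a‖ := by
  rw [norm_mul, norm_pow, Complex.norm_real, Real.norm_eq_abs, abs_of_pos hs.1]
  exact mul_le_of_le_one_left (norm_nonneg _) (pow_le_one₀ hs.1.le hs.2)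

theorem continuousOn_radialIntegrand (hS : IsRadial S) (h : ContinuousOn w S) (k : ℕ)
    {z : ℂ} (hz : z ∈ S) :
    ContinuousOn (fun s : ℝ => (s : ℂ) ^ k * w (s * z)) (Ioc 0 1) := by
  refine ContinuousOn.mul (by fun_prop) ?_
  exact h.comp (by fun_prop) fun s hs => hS z hz s hs

theorem aestronglyMeasurable_radialIntegrand (hS : IsRadial S) (h : ContinuousOn w S) (k : ℕ)
    {z : ℂ} (hz : z ∈ S) :
    MeasureTheory.AEStronglyMeasurable (fun s : ℝ => (s : ℂ) ^ k * w (s * z))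
      (MeasureTheory.volume.restrict (uIoc 0 1)) := by
  rw [uIoc_of_le zero_le_one]
  exact (continuousOn_radialIntegrand hS h k hz).aestronglyMeasurable measurableSet_Ioc

theorem ContBoundedOn.intervalIntegrable (hS : IsRadial S) (h : ContBoundedOn S M w) (k : ℕ)
    {z : ℂ} (hz : z ∈ S) :
    IntervalIntegrable (fun s : ℝ => (s : ℂ) ^ k * w (s * z)) MeasureTheory.volume 0 1 := by
  refine (intervalIntegrable_const (c := M)).mono_fun
    (aestronglyMeasurable_radialIntegrand hS h.cont k hz) ?_
  refine (MeasureTheory.ae_restrict_iff' measurableSet_uIoc).2 (Eventually.of_forall ?_)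
  intro s hs
  rw [uIoc_of_le zero_le_one] at hs
  exact ((norm_pow_mul_le_of_mem_Ioc hs k _).trans (h.bound _ (hS z hz s hs))).trans
    (le_abs_self M)

theorem radialMoment_congr (hS : IsRadial S) (h : EqOn w₁ w₂ S) (k : ℕ) :
    EqOn (radialMoment k w₁) (radialMoment k w₂) S := by
  intro z hz
  refine intervalIntegral.integral_congr_ae (Eventually.of_forall fun s hs => ?_)
  rw [uIoc_of_le zero_le_one] at hs
  simp only [h (hS z hz s hs)]

theorem norm_radialMoment_le (hS : IsRadial S) (h : ∀ z ∈ S, ‖w z‖ ≤ M) (k : ℕ) {z : ℂ}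
    (hz : z ∈ S) : ‖radialMoment k w z‖ ≤ M := by
  have := intervalIntegral.norm_integral_le_of_norm_le_const (a := 0) (b := 1) (C := M)
    (f := fun s : ℝ => (s : ℂ) ^ k * w (s * z)) (fun s hs => by
      rw [uIoc_of_le zero_le_one] at hs
      exact (norm_pow_mul_le_of_mem_Ioc hs k _).trans (h _ (hS z hz s hs)))
  simpa [radialMoment] using this

theorem ContBoundedOn.radialMoment (hS : IsRadial S) (h : ContBoundedOn S M w) (k : ℕ) :
    ContBoundedOn S M (radialMoment k w) := by
  refine ⟨fun z hz => ?_, fun z hz => norm_radialMoment_le hS h.bound k hz⟩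
  refine intervalIntegral.continuousWithinAt_of_dominated_interval (bound := fun _ => M) ?_ ?_
    intervalIntegrable_const ?_
  · filter_upwards [self_mem_nhdsWithin] with x hx
    exact aestronglyMeasurable_radialIntegrand hS h.cont k hx
  · filter_upwards [self_mem_nhdsWithin] with x hx
    refine Eventually.of_forall fun s hs => ?_
    rw [uIoc_of_le zero_le_one] at hs
    exact (norm_pow_mul_le_of_mem_Ioc hs k _).trans (h.bound _ (hS x hx s hs))
  · refine Eventually.of_forall fun s hs => ?_
    rw [uIoc_of_le zero_le_one] at hs
    refine continuousWithinAt_const.mul ?_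
    exact (h.cont _ (hS z hz s hs)).comp (f := fun x : ℂ => (s : ℂ) * x)
      (by fun_prop) fun x hx => hS x hx s hs

theorem norm_radialMoment_sub_le (hS : IsRadial S) (h₁ : ContBoundedOn S M w₁)
    (h₂ : ContBoundedOn S M w₂) (h : ∀ z ∈ S, ‖w₁ z - w₂ z‖ ≤ D) (k : ℕ) :
    ∀ z ∈ S, ‖radialMoment k w₁ z - radialMoment k w₂ z‖ ≤ D := by
  intro z hz
  have : radialMoment k w₁ z - radialMoment k w₂ z = radialMoment k (fun x => w₁ x - w₂ x) z := by
    simp only [radialMoment, mul_sub]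
    exact (intervalIntegral.integral_sub (h₁.intervalIntegrable hS k hz)
      (h₂.intervalIntegrable hS k hz)).symm
  rw [this]
  exact norm_radialMoment_le hS h k hz

theorem radialMoment_zero_right (k : ℕ) (w : ℂ → ℂ) :
    radialMoment k w 0 = w 0 / (k + 1) := by
  have : (fun s : ℝ => (s : ℂ) ^ k) = fun s : ℝ => ((s ^ k : ℝ) : ℂ) := by
    ext s; push_cast; rfl
  simp only [radialMoment, mul_zero, intervalIntegral.integral_mul_const, this,
    intervalIntegral.integral_ofReal, integral_pow]
  push_cast
  simp
  ring

theorem conj_radialMoment (k : ℕ) {t : ℝ}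
    (h : ∀ s ∈ Ioc (0 : ℝ) 1, (starRingEnd ℂ) (w (s * t)) = w (s * t)) :
    (starRingEnd ℂ) (radialMoment k w t) = radialMoment k w t := by
  simp only [radialMoment, intervalIntegral.integral_of_le zero_le_one]
  rw [← integral_conj]
  refine MeasureTheory.setIntegral_congr_fun measurableSet_Ioc fun s hs => ?_
  simp [h s hs]

theorem differentiableOn_radialMoment {r : ℝ} (h : DifferentiableOn ℂ w (Metric.ball 0 r)) (k : ℕ) :
    DifferentiableOn ℂ (radialMoment k w) (Metric.ball 0 r) := by
  intro z₀ hz₀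
  refine DifferentiableAt.differentiableWithinAt ?_
  -- On a smaller closed disc, compactness bounds `w` and `w'`, and the latter bound dominates the
  -- differentiated integrand.
  obtain ⟨ρ, hρ₁, hρ₂⟩ := exists_between (mem_ball_zero_iff.1 hz₀)
  have hsub : Metric.closedBall (0 : ℂ) ρ ⊆ Metric.ball 0 r := Metric.closedBall_subset_ball hρ₂
  have hd : ContinuousOn (deriv w) (Metric.ball 0 r) :=
    (h.deriv Metric.isOpen_ball).continuousOn
  obtain ⟨B, hB⟩ := (isCompact_closedBall (0 : ℂ) ρ).exists_bound_of_continuousOn (hd.mono hsub)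
  have hz₀' : z₀ ∈ Metric.ball (0 : ℂ) ρ := mem_ball_zero_iff.2 hρ₁
  obtain ⟨B₀, hB₀⟩ := (isCompact_closedBall (0 : ℂ) ρ).exists_bound_of_continuousOn
    (h.continuousOn.mono hsub)
  have hsubρ : Metric.ball (0 : ℂ) ρ ⊆ Metric.closedBall 0 ρ := Metric.ball_subset_closedBall
  have hw : ContBoundedOn (Metric.ball 0 ρ) B₀ w :=
    ⟨h.continuousOn.mono (hsubρ.trans hsub), fun z hz => hB₀ z (hsubρ hz)⟩
  have key := intervalIntegral.hasDerivAt_integral_of_dominated_loc_of_deriv_le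
    (μ := MeasureTheory.volume) (a := 0) (b := 1)
    (F := fun z (s : ℝ) => (s : ℂ) ^ k * w (s * z))
    (F' := fun z (s : ℝ) => (s : ℂ) ^ (k + 1) * deriv w (s * z)) (x₀ := z₀)
    (s := Metric.ball 0 ρ) (bound := fun _ => B) (Metric.isOpen_ball.mem_nhds hz₀') ?_
    (hw.intervalIntegrable (isRadial_ball ρ) k hz₀')
    (aestronglyMeasurable_radialIntegrand (isRadial_ball ρ) (hd.mono (hsubρ.trans hsub)) (k + 1) hz₀')
    ?_ intervalIntegrable_const ?_
  · exact key.2.differentiableAt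
  · filter_upwards [Metric.isOpen_ball.mem_nhds hz₀'] with x hx
    exact aestronglyMeasurable_radialIntegrand (isRadial_ball ρ) hw.cont k hx
  · refine Eventually.of_forall fun s hs x hx => ?_
    rw [uIoc_of_le zero_le_one] at hs
    exact (norm_pow_mul_le_of_mem_Ioc hs _ _).trans (hB _ (hsubρ (isRadial_ball ρ x hx s hs)))
  · refine Eventually.of_forall fun s hs x hx => ?_
    rw [uIoc_of_le zero_le_one] at hs
    have hx' := (h.differentiableAt (Metric.isOpen_ball.mem_nhds
      (hsub (hsubρ (isRadial_ball ρ x hx s hs))))).hasDerivAt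
    have hm : HasDerivAt (fun x : ℂ => (s : ℂ) * x) s x := by
      simpa using (hasDerivAt_id x).const_mul (s : ℂ)
    have := (hx'.comp x hm).const_mul ((s : ℂ) ^ k)
    refine this.congr_deriv ?_
    ring

/-- The fundamental theorem of calculus for `tᵏ⁺¹ ∫₀¹ sᵏ w(s t) ds = ∫₀ᵗ xᵏ w(x) dx`. -/
theorem hasDerivAt_radialMoment {r : ℝ} (h : ContBoundedOn (Complex.ofReal '' Ioo 0 r) M w) (k : ℕ)
    {t : ℝ} (ht : t ∈ Ioo 0 r) :
    HasDerivAt (fun t : ℝ => (t : ℂ) ^ (k + 1) * radialMoment k w t) ((t : ℂ) ^ k * w t) t := by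
  have heq : (fun t : ℝ => (t : ℂ) ^ (k + 1) * radialMoment k w t)
      = fun t : ℝ => ∫ x in (0 : ℝ)..t, (x : ℂ) ^ k * w x := by
    ext t
    have := intervalIntegral.smul_integral_comp_mul_right (a := 0) (b := 1)
      (fun x : ℝ => (x : ℂ) ^ k * w x) t
    rw [zero_mul, one_mul] at this
    rw [← this, radialMoment, pow_succ', mul_assoc, ← intervalIntegral.integral_const_mul,
      Complex.real_smul]
    congr 2
    ext s
    push_cast
    ring
  rw [heq]
  have hc : ContinuousOn (fun x : ℝ => (x : ℂ) ^ k * w x) (Ioo 0 r) := by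
    refine ContinuousOn.mul (by fun_prop) ?_
    exact h.cont.comp Complex.continuous_ofReal.continuousOn fun x hx => ⟨x, hx, rfl⟩
  refine intervalIntegral.integral_hasDerivAt_right ?_
    (hc.stronglyMeasurableAtFilter isOpen_Ioo t ht) (hc.continuousAt (Ioo_mem_nhds ht.1 ht.2))
  have hsub : Ioc 0 t ⊆ Ioo 0 r := fun x hx => ⟨hx.1, hx.2.trans_lt ht.2⟩
  -- No continuity at `0` is available; integrability up to `0` comes from the bound `M`.
  refine (intervalIntegrable_const (c := t ^ k * M)).mono_fun ?_ ?_
  · rw [uIoc_of_le ht.1.le]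
    exact (hc.mono hsub).aestronglyMeasurable measurableSet_Ioc
  · refine (MeasureTheory.ae_restrict_iff' measurableSet_uIoc).2 (Eventually.of_forall ?_)
    intro s hs
    rw [uIoc_of_le ht.1.le] at hs
    refine le_trans (b := t ^ k * M) ?_ (le_abs_self _)
    change ‖(s : ℂ) ^ k * w s‖ ≤ _
    rw [norm_mul, norm_pow, Complex.norm_real, Real.norm_eq_abs, abs_of_pos hs.1]
    exact mul_le_mul (pow_le_pow_left₀ hs.1.le hs.2 k) (h.bound _ ⟨s, hsub hs, rfl⟩)
      (norm_nonneg _) (pow_nonneg ht.1.le k)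

end

/-! ### The integral operator and its contraction estimate. -/

/-- The third derivative `g'''` expressed through `u = g / t²` for the equation
`(g (2 - g) g''')' = -(y₀ - t) g' / 4` with vanishing flux at `t = 0`. -/
noncomputable def thirdDerivOfQuotient (y₀ : ℝ) (u : ℂ → ℂ) (z : ℂ) : ℂ :=
  -((y₀ - z) + z * (radialMoment 2 u z / u z)) / (4 * (2 - z ^ 2 * u z))

/-- The quotient `g / t²` of the function `g` with `g(0) = g'(0) = 0`, `g''(0) = 2 C`,
`g''' = w`. -/
noncomputable def quotientOfThirdDeriv (C : ℝ) (w : ℂ → ℂ) (z : ℂ) : ℂ :=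
  C + z * radialMoment 2 (radialMoment 1 (radialMoment 0 w)) z

/-- The integral operator whose fixed points are the third derivatives of solutions. -/
noncomputable def profileMap (y₀ C : ℝ) (w : ℂ → ℂ) : ℂ → ℂ :=
  thirdDerivOfQuotient y₀ (quotientOfThirdDeriv C w)

/-- Smallness conditions making `profileMap y₀ C` a contraction on radial sets of radius `r`. -/
structure SmallRadius (y₀ C r : ℝ) : Prop where
  pos : 0 < r
  le_one : r ≤ 1
  mul_le_one : r * (y₀ + 4) ≤ 1
  mul_le : r * (y₀ + 4) ≤ C / 2
  mul_C_le : r * (3 * C / 2) ≤ 1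
  le_C : 12 * r ≤ C

theorem SmallRadius.mono {y₀ C r r' : ℝ} (hy₀ : 0 < y₀) (hC : 0 < C) (h : SmallRadius y₀ C r)
    (h0 : 0 < r') (hr : r' ≤ r) : SmallRadius y₀ C r' := by
  obtain ⟨h1, h2, h3, h4, h5, h6⟩ := h
  refine ⟨h0, hr.trans h2, ?_, ?_, ?_, by linarith⟩
  · nlinarith
  · nlinarith
  · nlinarith

/-- Roles of the constraints: `mul_le` keeps `u` within `C / 2` of `C`, `mul_C_le` keeps `2 - z² u`
away from `0`, and `le_C` and `mul_le_one` control the variation of the numerator and of the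
denominator in the contraction estimate. -/
theorem exists_smallRadius {y₀ C : ℝ} (hy₀ : 0 < y₀) (hC : 0 < C) :
    ∃ r, SmallRadius y₀ C r := by
  have h4 : 0 < y₀ + 4 := by linarith
  refine ⟨min (1 / (y₀ + 4)) (min (C / 2 / (y₀ + 4)) (min (1 / (3 * C / 2)) (C / 12))), ?_⟩
  have h5 : 1 / (y₀ + 4) ≤ 1 := by rw [div_le_one h4]; linarith
  refine ⟨by positivity, (min_le_left _ _).trans h5, ?_, ?_, ?_, ?_⟩
  · exact (le_div_iff₀ h4).1 (min_le_left _ _)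
  · exact (le_div_iff₀ h4).1 ((min_le_right _ _).trans (min_le_left _ _))
  · exact (le_div_iff₀ (by positivity)).1
      ((min_le_right _ _).trans ((min_le_right _ _).trans (min_le_left _ _)))
  · have : min (1 / (y₀ + 4)) (min (C / 2 / (y₀ + 4)) (min (1 / (3 * C / 2)) (C / 12))) ≤ C / 12 :=
      (min_le_right _ _).trans ((min_le_right _ _).trans (min_le_right _ _))
    linarith

section
variable {S : Set ℂ} {y₀ C r M D : ℝ} {u u₁ u₂ w w₁ w₂ : ℂ → ℂ}

theorem norm_bounds_of_norm_sub_le {a : ℂ} (hC : 0 < C) (h : ‖a - C‖ ≤ C / 2) :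
    C / 2 ≤ ‖a‖ ∧ ‖a‖ ≤ 3 * C / 2 := by
  have hn : ‖(C : ℂ)‖ = C := by simp [abs_of_pos hC]
  have h1 := norm_sub_norm_le (C : ℂ) a
  have h2 := norm_sub_norm_le a (C : ℂ)
  rw [norm_sub_rev] at h1
  constructor <;> linarith

theorem SmallRadius.norm_two_sub (hC : 0 < C) (hr : SmallRadius y₀ C r) {z a : ℂ} (hz : ‖z‖ < r)
    (h : ‖a - C‖ ≤ C / 2) : 1 ≤ ‖2 - z ^ 2 * a‖ := by
  have ha := (norm_bounds_of_norm_sub_le hC h).2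
  have h1 := norm_sub_norm_le (2 : ℂ) (z ^ 2 * a)
  have h2 : ‖z ^ 2 * a‖ ≤ 1 := by
    rw [norm_mul, norm_pow]
    have h3 : ‖z‖ ^ 2 ≤ r := by nlinarith [norm_nonneg z, hr.le_one]
    calc ‖z‖ ^ 2 * ‖a‖ ≤ r * (3 * C / 2) :=
          mul_le_mul h3 ha (norm_nonneg _) hr.pos.le
      _ ≤ 1 := hr.mul_C_le
  have h3 : ‖(2 : ℂ)‖ = 2 := by simp
  linarith

theorem ContBoundedOn.of_norm_sub_le (hC : 0 < C) (huc : ContinuousOn u S)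
    (hu : ∀ z ∈ S, ‖u z - C‖ ≤ C / 2) : ContBoundedOn S (3 * C / 2) u :=
  ⟨huc, fun z hz => (norm_bounds_of_norm_sub_le hC (hu z hz)).2⟩

/-- The `4` is `1 + 3`: `‖z‖ ≤ 1`, and the ratio of the bounds `3 C / 2` and `C / 2` is `3`. -/
theorem norm_numerator_le (hy₀ : 0 < y₀) (hC : 0 < C) (hr : SmallRadius y₀ C r) {z a b : ℂ}
    (hz : ‖z‖ < r) (ha : C / 2 ≤ ‖a‖) (hb : ‖b‖ ≤ 3 * C / 2) :
    ‖-((y₀ - z) + z * (b / a))‖ ≤ y₀ + 4 := by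
  have h0 : ‖b / a‖ ≤ 3 := by
    rw [norm_div, div_le_iff₀ (by linarith)]
    linarith
  have hn : ‖(y₀ : ℂ)‖ = y₀ := by simp [abs_of_pos hy₀]
  have h1 := norm_add_le ((y₀ : ℂ) - z) (z * (b / a))
  have h2 := norm_sub_le (y₀ : ℂ) z
  have h3 : ‖z * (b / a)‖ ≤ 1 * 3 := by
    rw [norm_mul]
    exact mul_le_mul (hz.le.trans hr.le_one) h0 (norm_nonneg _) zero_le_one
  rw [norm_neg]
  linarith [hr.le_one]

theorem thirdDerivOfQuotient_contBoundedOn (hy₀ : 0 < y₀) (hC : 0 < C) (hr : SmallRadius y₀ C r)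
    (hS : IsRadial S) (hSr : ∀ z ∈ S, ‖z‖ < r)
    (huc : ContinuousOn u S) (hu : ∀ z ∈ S, ‖u z - C‖ ≤ C / 2) :
    ContBoundedOn S (y₀ + 4) (thirdDerivOfQuotient y₀ u) := by
  have hub := ContBoundedOn.of_norm_sub_le hC huc hu
  have hub2 := hub.radialMoment hS 2
  have hden : ∀ z ∈ S, 4 ≤ ‖4 * (2 - z ^ 2 * u z)‖ := by
    intro z hz
    rw [norm_mul]
    have := hr.norm_two_sub hC (hSr z hz) (hu z hz)
    have h4 : ‖(4 : ℂ)‖ = 4 := by simp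
    rw [h4]
    linarith
  constructor
  · unfold thirdDerivOfQuotient
    refine ContinuousOn.div ?_ ?_ ?_
    · refine ((continuousOn_const.sub continuousOn_id).add
        (continuousOn_id.mul (hub2.cont.div huc ?_))).neg
      intro z hz h0
      have := (norm_bounds_of_norm_sub_le hC (hu z hz)).1
      rw [h0, norm_zero] at this
      linarith
    · exact continuousOn_const.mul (continuousOn_const.sub ((continuousOn_id.pow 2).mul huc))
    · intro z hz h0
      have := hden z hz
      rw [h0, norm_zero] at this
      linarith
  · intro z hz
    have hN := norm_numerator_le hy₀ hC hr (hSr z hz) (norm_bounds_of_norm_sub_le hC (hu z hz)).1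
      (hub2.bound z hz)
    rw [thirdDerivOfQuotient, norm_div, div_le_iff₀ (by linarith [hden z hz])]
    nlinarith [hden z hz]

theorem norm_div_sub_div_le {a₁ a₂ b₁ b₂ : ℂ} {A B E c : ℝ} (hc : 0 < c) (h₁ : c ≤ ‖b₁‖)
    (h₂ : c ≤ ‖b₂‖) (ha : ‖a₁ - a₂‖ ≤ A) (hb : ‖b₁ - b₂‖ ≤ B) (hE : ‖a₂‖ ≤ E) :
    ‖a₁ / b₁ - a₂ / b₂‖ ≤ A / c + E * B / c ^ 2 := by
  have hb₁ : b₁ ≠ 0 := norm_pos_iff.1 (by linarith)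
  have hb₂ : b₂ ≠ 0 := norm_pos_iff.1 (by linarith)
  have hA : 0 ≤ A := (norm_nonneg _).trans ha
  have hB : 0 ≤ B := (norm_nonneg _).trans hb
  have hE0 : 0 ≤ E := (norm_nonneg _).trans hE
  have : a₁ / b₁ - a₂ / b₂ = (a₁ - a₂) / b₁ - a₂ * (b₁ - b₂) / (b₁ * b₂) := by
    field_simp
    ring
  rw [this]
  refine (norm_sub_le _ _).trans (add_le_add ?_ ?_)
  · rw [norm_div]
    exact div_le_div₀ hA ha hc h₁
  · rw [norm_div, norm_mul, norm_mul, sq]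
    exact div_le_div₀ (mul_nonneg hE0 hB) (mul_le_mul hE hb (norm_nonneg _) hE0) (by positivity)
      (mul_le_mul h₁ h₂ hc.le (norm_nonneg _))

/-- The factor `r` in `hD` is supplied by the prefactor `z` in `quotientOfThirdDeriv`; it is what
produces the contraction. -/
theorem norm_thirdDerivOfQuotient_sub_le (hy₀ : 0 < y₀) (hC : 0 < C) (hr : SmallRadius y₀ C r)
    (hS : IsRadial S) (hSr : ∀ z ∈ S, ‖z‖ < r)
    (huc₁ : ContinuousOn u₁ S) (hu₁ : ∀ z ∈ S, ‖u₁ z - C‖ ≤ C / 2)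
    (huc₂ : ContinuousOn u₂ S) (hu₂ : ∀ z ∈ S, ‖u₂ z - C‖ ≤ C / 2)
    (hD : ∀ z ∈ S, ‖u₁ z - u₂ z‖ ≤ r * D) :
    ∀ z ∈ S, ‖thirdDerivOfQuotient y₀ u₁ z - thirdDerivOfQuotient y₀ u₂ z‖ ≤ D / 2 := by
  intro z hz
  have hb₁ := ContBoundedOn.of_norm_sub_le hC huc₁ hu₁
  have hb₂ := ContBoundedOn.of_norm_sub_le hC huc₂ hu₂
  have hm := norm_radialMoment_sub_le hS hb₁ hb₂ hD 2 z hz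
  have hn₁ := norm_bounds_of_norm_sub_le hC (hu₁ z hz)
  have hn₂ := norm_bounds_of_norm_sub_le hC (hu₂ z hz)
  have hzr := hSr z hz
  have hr0 := hr.pos
  have hrD : 0 ≤ r * D := (norm_nonneg _).trans (hD z hz)
  have hD0 : 0 ≤ D := nonneg_of_mul_nonneg_right hrD hr0
  have hq := norm_div_sub_div_le (half_pos hC) hn₁.1 hn₂.1 hm (hD z hz)
    (norm_radialMoment_le hS hb₂.bound 2 hz)
  have hden : ∀ a : ℂ, ‖a - C‖ ≤ C / 2 → 4 ≤ ‖4 * (2 - z ^ 2 * a)‖ := by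
    intro a ha
    rw [norm_mul]
    have := hr.norm_two_sub hC hzr ha
    have h4 : ‖(4 : ℂ)‖ = 4 := by simp
    rw [h4]
    linarith
  have hqs : r * D / (C / 2) + 3 * C / 2 * (r * D) / (C / 2) ^ 2 = 8 * (r * D) / C := by
    field_simp
    ring
  rw [hqs] at hq
  have hnum : ‖-((y₀ - z) + z * (radialMoment 2 u₁ z / u₁ z))
      - -((y₀ - z) + z * (radialMoment 2 u₂ z / u₂ z))‖ ≤ D := by
    have : -((y₀ - z) + z * (radialMoment 2 u₁ z / u₁ z))
      - -((y₀ - z) + z * (radialMoment 2 u₂ z / u₂ z))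
      = -(z * (radialMoment 2 u₁ z / u₁ z - radialMoment 2 u₂ z / u₂ z)) := by ring
    rw [this, norm_neg, norm_mul]
    calc _ ≤ 1 * (8 * (r * D) / C) :=
          mul_le_mul (hzr.le.trans hr.le_one) hq (norm_nonneg _) zero_le_one
      _ ≤ D := by
        rw [one_mul, div_le_iff₀ hC]
        nlinarith [hr.le_C]
  have hdd : ‖4 * (2 - z ^ 2 * u₁ z) - 4 * (2 - z ^ 2 * u₂ z)‖ ≤ 4 * (r * D) := by
    have : 4 * (2 - z ^ 2 * u₁ z) - 4 * (2 - z ^ 2 * u₂ z) = -(4 * (z ^ 2 * (u₁ z - u₂ z))) := by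
      ring
    have h4 : ‖(4 : ℂ)‖ = 4 := by simp
    rw [this, norm_neg, norm_mul, h4, norm_mul, norm_pow]
    have h1 : ‖z‖ ^ 2 ≤ 1 := pow_le_one₀ (norm_nonneg _) (hzr.le.trans hr.le_one)
    nlinarith [hD z hz, norm_nonneg (u₁ z - u₂ z)]
  have hfin := norm_div_sub_div_le four_pos (hden _ (hu₁ z hz)) (hden _ (hu₂ z hz)) hnum hdd
    (norm_numerator_le hy₀ hC hr hzr hn₂.1 (norm_radialMoment_le hS hb₂.bound 2 hz))
  refine hfin.trans ?_
  -- The bound is `D / 4 + (y₀ + 4) * (4 r D) / 16`, and each term is at most `D / 4`.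
  nlinarith [mul_le_mul_of_nonneg_right hr.mul_le_one hD0]

theorem norm_quotientOfThirdDeriv_sub_le (hr : SmallRadius y₀ C r)
    (hS : IsRadial S) (hSr : ∀ z ∈ S, ‖z‖ < r) (hw : ContBoundedOn S (y₀ + 4) w) :
    ContinuousOn (quotientOfThirdDeriv C w) S ∧
      ∀ z ∈ S, ‖quotientOfThirdDeriv C w z - C‖ ≤ C / 2 := by
  have hv := ((hw.radialMoment hS 0).radialMoment hS 1).radialMoment hS 2
  refine ⟨continuousOn_const.add (continuousOn_id.mul hv.cont), fun z hz => ?_⟩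
  rw [quotientOfThirdDeriv, add_sub_cancel_left, norm_mul]
  exact (mul_le_mul (hSr z hz).le (hv.bound z hz) (norm_nonneg _) hr.pos.le).trans hr.mul_le

theorem profileMap_contBoundedOn (hy₀ : 0 < y₀) (hC : 0 < C) (hr : SmallRadius y₀ C r)
    (hS : IsRadial S) (hSr : ∀ z ∈ S, ‖z‖ < r) (hw : ContBoundedOn S (y₀ + 4) w) :
    ContBoundedOn S (y₀ + 4) (profileMap y₀ C w) :=
  have h := norm_quotientOfThirdDeriv_sub_le hr hS hSr hw
  thirdDerivOfQuotient_contBoundedOn hy₀ hC hr hS hSr h.1 h.2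

theorem norm_profileMap_sub_le (hy₀ : 0 < y₀) (hC : 0 < C) (hr : SmallRadius y₀ C r)
    (hS : IsRadial S) (hSr : ∀ z ∈ S, ‖z‖ < r) (hw₁ : ContBoundedOn S (y₀ + 4) w₁)
    (hw₂ : ContBoundedOn S (y₀ + 4) w₂) (hD : ∀ z ∈ S, ‖w₁ z - w₂ z‖ ≤ D) :
    ∀ z ∈ S, ‖profileMap y₀ C w₁ z - profileMap y₀ C w₂ z‖ ≤ D / 2 := by
  have h₁ := norm_quotientOfThirdDeriv_sub_le hr hS hSr hw₁
  have h₂ := norm_quotientOfThirdDeriv_sub_le hr hS hSr hw₂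
  refine norm_thirdDerivOfQuotient_sub_le hy₀ hC hr hS hSr h₁.1 h₁.2 h₂.1 h₂.2 fun z hz => ?_
  have a₁ := hw₁.radialMoment hS 0
  have a₂ := hw₂.radialMoment hS 0
  have hv := norm_radialMoment_sub_le hS (a₁.radialMoment hS 1) (a₂.radialMoment hS 1)
    (norm_radialMoment_sub_le hS a₁ a₂ (norm_radialMoment_sub_le hS hw₁ hw₂ hD 0) 1) 2 z hz
  rw [quotientOfThirdDeriv, quotientOfThirdDeriv, add_sub_add_left_eq_sub, ← mul_sub, norm_mul]
  exact mul_le_mul (hSr z hz).le hv (norm_nonneg _) hr.pos.le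

/-- The a priori bound `2 (y₀ + 4)` on the difference can be halved indefinitely. Any radial set is
allowed, in particular the punctured real segment. -/
theorem profileMap_fixedPoint_unique (hy₀ : 0 < y₀) (hC : 0 < C) (hr : SmallRadius y₀ C r)
    (hS : IsRadial S) (hSr : ∀ z ∈ S, ‖z‖ < r) (hw₁ : ContBoundedOn S (y₀ + 4) w₁)
    (hw₂ : ContBoundedOn S (y₀ + 4) w₂) (h₁ : EqOn (profileMap y₀ C w₁) w₁ S)
    (h₂ : EqOn (profileMap y₀ C w₂) w₂ S) : EqOn w₁ w₂ S := by
  have key : ∀ n : ℕ, ∀ z ∈ S, ‖w₁ z - w₂ z‖ ≤ 2 * (y₀ + 4) * (1 / 2) ^ n := by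
    intro n
    induction n with
    | zero =>
      intro z hz
      have := norm_sub_le (w₁ z) (w₂ z)
      linarith [hw₁.bound z hz, hw₂.bound z hz]
    | succ n ih =>
      intro z hz
      have := norm_profileMap_sub_le hy₀ hC hr hS hSr hw₁ hw₂ ih z hz
      rw [h₁ hz, h₂ hz] at this
      rw [pow_succ]
      linarith
  intro z hz
  have hlim : Tendsto (fun n : ℕ => 2 * (y₀ + 4) * (1 / 2 : ℝ) ^ n) atTop (𝓝 (2 * (y₀ + 4) * 0)) :=
    (tendsto_pow_atTop_nhds_zero_of_lt_one (by norm_num) (by norm_num)).const_mul _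
  rw [mul_zero] at hlim
  have := ge_of_tendsto' hlim fun n => key n z hz
  exact sub_eq_zero.1 (norm_le_zero_iff.1 this)

/-! ### Holomorphy and reality of the fixed point. -/

theorem differentiableOn_quotientOfThirdDeriv (h : DifferentiableOn ℂ w (Metric.ball 0 r)) :
    DifferentiableOn ℂ (quotientOfThirdDeriv C w) (Metric.ball 0 r) :=
  (differentiableOn_const _).add (differentiableOn_id.mul (differentiableOn_radialMoment
    (differentiableOn_radialMoment (differentiableOn_radialMoment h 0) 1) 2))

theorem differentiableOn_profileMap (hC : 0 < C) (hr : SmallRadius y₀ C r)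
    (hw : ContBoundedOn (Metric.ball 0 r) (y₀ + 4) w)
    (h : DifferentiableOn ℂ w (Metric.ball 0 r)) :
    DifferentiableOn ℂ (profileMap y₀ C w) (Metric.ball 0 r) := by
  have hu := differentiableOn_quotientOfThirdDeriv (C := C) h
  have hb := (norm_quotientOfThirdDeriv_sub_le hr (isRadial_ball r)
    (fun z hz => mem_ball_zero_iff.1 hz) hw).2
  unfold profileMap thirdDerivOfQuotient
  refine DifferentiableOn.div ?_ ?_ ?_
  · refine (((differentiableOn_const _).sub differentiableOn_id).add
      (differentiableOn_id.mul ((differentiableOn_radialMoment hu 2).div hu ?_))).neg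
    intro z hz h0
    have := (norm_bounds_of_norm_sub_le hC (hb z hz)).1
    rw [h0, norm_zero] at this
    linarith
  · exact (differentiableOn_const _).mul
      ((differentiableOn_const _).sub ((differentiableOn_id.pow 2).mul hu))
  · intro z hz h0
    have := hr.norm_two_sub hC (mem_ball_zero_iff.1 hz) (hb z hz)
    rw [(mul_eq_zero.1 h0).resolve_left (show (4 : ℂ) ≠ 0 by norm_num), norm_zero] at this
    linarith

theorem conj_quotientOfThirdDeriv
    (h : ∀ t : ℝ, |t| < r → (starRingEnd ℂ) (w t) = w t) :
    ∀ t : ℝ, |t| < r → (starRingEnd ℂ) (quotientOfThirdDeriv C w t)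
      = quotientOfThirdDeriv C w t := by
  have step : ∀ (k : ℕ) (v : ℂ → ℂ), (∀ t : ℝ, |t| < r → (starRingEnd ℂ) (v t) = v t) →
      ∀ t : ℝ, |t| < r → (starRingEnd ℂ) (radialMoment k v t) = radialMoment k v t := by
    intro k v hv t ht
    refine conj_radialMoment k fun s hs => ?_
    rw [← Complex.ofReal_mul]
    refine hv _ ?_
    rw [abs_mul, abs_of_pos hs.1]
    nlinarith [hs.1, hs.2, abs_nonneg t]
  intro t ht
  simp only [quotientOfThirdDeriv, map_add, map_mul, Complex.conj_ofReal,
    step 2 _ (step 1 _ (step 0 _ h)) t ht]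

theorem conj_profileMap (h : ∀ t : ℝ, |t| < r → (starRingEnd ℂ) (w t) = w t) :
    ∀ t : ℝ, |t| < r → (starRingEnd ℂ) (profileMap y₀ C w t) = profileMap y₀ C w t := by
  intro t ht
  have hu := conj_quotientOfThirdDeriv (C := C) h
  have hm : (starRingEnd ℂ) (radialMoment 2 (quotientOfThirdDeriv C w) t)
      = radialMoment 2 (quotientOfThirdDeriv C w) t := by
    refine conj_radialMoment 2 fun s hs => ?_
    rw [← Complex.ofReal_mul]
    refine hu _ ?_
    rw [abs_mul, abs_of_pos hs.1]
    nlinarith [hs.1, hs.2, abs_nonneg t]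
  simp only [profileMap, thirdDerivOfQuotient, map_div₀, map_neg, map_add, map_sub, map_mul,
    map_pow, Complex.conj_ofReal, hu t ht, hm, map_ofNat]

/-- The holomorphic fixed point, real on the real axis. -/
theorem exists_profileMap_fixedPoint (hy₀ : 0 < y₀) (hC : 0 < C) (hr : SmallRadius y₀ C r) :
    ∃ w : ℂ → ℂ, DifferentiableOn ℂ w (Metric.ball 0 r) ∧
      ContBoundedOn (Metric.ball 0 r) (y₀ + 4) w ∧
      EqOn (profileMap y₀ C w) w (Metric.ball 0 r) ∧
      ∀ t : ℝ, |t| < r → (starRingEnd ℂ) (w t) = w t := by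
  set S : Set ℂ := Metric.ball 0 r with hSdef
  have hS : IsRadial S := isRadial_ball r
  have hSr : ∀ z ∈ S, ‖z‖ < r := fun z hz => mem_ball_zero_iff.1 hz
  let W : ℕ → ℂ → ℂ := fun n => (profileMap y₀ C)^[n] 0
  have hWs : ∀ n, W (n + 1) = profileMap y₀ C (W n) := fun n =>
    Function.iterate_succ_apply' _ _ _
  have hW : ∀ n, ContBoundedOn S (y₀ + 4) (W n) ∧ DifferentiableOn ℂ (W n) S ∧
      ∀ t : ℝ, |t| < r → (starRingEnd ℂ) (W n t) = W n t := by
    intro n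
    induction n with
    | zero =>
      refine ⟨⟨continuousOn_const, fun z _ => ?_⟩, differentiableOn_const _, fun t _ => ?_⟩
      · simp only [W, Function.iterate_zero, id, Pi.zero_apply, norm_zero]
        linarith
      · simp [W]
    | succ n ih =>
      rw [hWs]
      exact ⟨profileMap_contBoundedOn hy₀ hC hr hS hSr ih.1,
        differentiableOn_profileMap hC hr ih.1 ih.2.1, conj_profileMap ih.2.2⟩
  have hdist : ∀ n, ∀ z ∈ S, dist (W n z) (W (n + 1) z) ≤ (y₀ + 4) * (1 / 2) ^ n := by
    intro n
    induction n with
    | zero =>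
      intro z hz
      rw [dist_comm, dist_eq_norm]
      simpa [W] using (hW 1).1.bound z hz
    | succ n ih =>
      intro z hz
      have := norm_profileMap_sub_le hy₀ hC hr hS hSr (hW n).1 (hW (n + 1)).1
        (fun z hz => by rw [← dist_eq_norm]; exact ih z hz) z hz
      rw [← hWs, ← hWs, ← dist_eq_norm] at this
      rw [pow_succ]
      linarith
  have hlim : ∀ z, ∃ a, z ∈ S → Tendsto (fun n => W n z) atTop (𝓝 a) := by
    intro z
    by_cases hz : z ∈ S
    · obtain ⟨a, ha⟩ := cauchySeq_tendsto_of_complete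
        (cauchySeq_of_le_geometric _ _ (by norm_num) fun n => hdist n z hz)
      exact ⟨a, fun _ => ha⟩
    · exact ⟨0, fun h => absurd h hz⟩
  choose w hw using hlim
  -- Tail of the geometric series; uniformity in `z` makes the limit holomorphic by Weierstrass'
  -- theorem.
  have hdw : ∀ n, ∀ z ∈ S, dist (W n z) (w z) ≤ 2 * (y₀ + 4) * (1 / 2) ^ n := by
    intro n z hz
    have := dist_le_of_le_geometric_of_tendsto (1 / 2 : ℝ) (y₀ + 4) (by norm_num)
      (fun n => hdist n z hz) (hw z hz) n
    exact this.trans_eq (by ring)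
  have hlim0 : Tendsto (fun n : ℕ => 2 * (y₀ + 4) * (1 / 2 : ℝ) ^ n) atTop (𝓝 0) := by
    simpa using (tendsto_pow_atTop_nhds_zero_of_lt_one (r := (1 / 2 : ℝ)) (by norm_num)
      (by norm_num)).const_mul (2 * (y₀ + 4))
  have hunif : TendstoUniformlyOn W w atTop S := by
    rw [Metric.tendstoUniformlyOn_iff]
    intro ε hε
    filter_upwards [hlim0.eventually_lt_const hε] with n hn z hz
    rw [dist_comm]
    exact (hdw n z hz).trans_lt hn
  have hdiff : DifferentiableOn ℂ w S :=
    hunif.tendstoLocallyUniformlyOn.differentiableOn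
      (Eventually.of_forall fun n => (hW n).2.1) Metric.isOpen_ball
  have hwb : ContBoundedOn S (y₀ + 4) w :=
    ⟨hdiff.continuousOn, fun z hz => le_of_tendsto' (hw z hz).norm fun n => (hW n).1.bound z hz⟩
  refine ⟨w, hdiff, hwb, fun z hz => ?_, fun t ht => ?_⟩
  · have h1 : Tendsto (fun n => W (n + 1) z) atTop (𝓝 (profileMap y₀ C w z)) := by
      rw [tendsto_iff_dist_tendsto_zero]
      refine squeeze_zero (fun _ => dist_nonneg) (fun n => ?_) hlim0
      have := norm_profileMap_sub_le hy₀ hC hr hS hSr (hW n).1 hwb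
        (fun z hz => by rw [← dist_eq_norm]; exact hdw n z hz) z hz
      rw [hWs, dist_eq_norm]
      have : 0 ≤ 2 * (y₀ + 4) * (1 / 2) ^ n := by positivity
      linarith
    exact tendsto_nhds_unique h1 ((tendsto_add_atTop_iff_nat 1).2 (hw z hz))
  · have hz : (t : ℂ) ∈ S := by simpa [hSdef] using ht
    refine tendsto_nhds_unique ((Complex.continuous_conj.tendsto _).comp (hw _ hz)) ?_
    refine (hw _ hz).congr fun n => ?_
    exact ((hW n).2.2 t ht).symm

end

/-! ### Third differences and constants of integration. -/

/-- Three nested mean value theorems. The nodes start at `t`, not `0`, to stay inside the open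
interval. Since third differences kill quadratics, an `O(t³)` remainder for `g` bounds `g₃` at some
point of `(t, 4t)`. -/
theorem exists_third_difference_eq {g g₁ g₂ g₃ : ℝ → ℝ} {δ : ℝ}
    (h₁ : ∀ t ∈ Ioo 0 δ, HasDerivAt g (g₁ t) t) (h₂ : ∀ t ∈ Ioo 0 δ, HasDerivAt g₁ (g₂ t) t)
    (h₃ : ∀ t ∈ Ioo 0 δ, HasDerivAt g₂ (g₃ t) t) {t : ℝ} (ht : 0 < t) (htδ : 4 * t < δ) :
    ∃ ξ ∈ Ioo t (4 * t), g (4 * t) - 3 * g (3 * t) + 3 * g (2 * t) - g t = t ^ 3 * g₃ ξ := by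
  have hφ : ∀ x ∈ Icc t (2 * t), HasDerivAt (fun x => g (x + 2 * t) - 2 * g (x + t) + g x)
      (g₁ (x + 2 * t) - 2 * g₁ (x + t) + g₁ x) x := by
    intro x hx
    have e1 := (h₁ (x + 2 * t) ⟨by linarith [hx.1], by linarith [hx.2]⟩).comp_add_const x (2 * t)
    have e2 := (h₁ (x + t) ⟨by linarith [hx.1], by linarith [hx.2]⟩).comp_add_const x t
    have e3 := h₁ x ⟨by linarith [hx.1], by linarith [hx.2]⟩
    exact (e1.sub (e2.const_mul 2)).add e3
  obtain ⟨a, ha, hae⟩ := exists_hasDerivAt_eq_slope _ _ (by linarith : t < 2 * t)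
    (fun x hx => (hφ x hx).continuousAt.continuousWithinAt)
    (fun x hx => hφ x (Ioo_subset_Icc_self hx))
  have hψ : ∀ x ∈ Icc a (a + t), HasDerivAt (fun x => g₁ (x + t) - g₁ x)
      (g₂ (x + t) - g₂ x) x := by
    intro x hx
    have e2 := (h₂ (x + t) ⟨by linarith [hx.1, ha.1], by linarith [hx.2, ha.2]⟩).comp_add_const x t
    have e3 := h₂ x ⟨by linarith [hx.1, ha.1], by linarith [hx.2, ha.2]⟩
    exact e2.sub e3
  obtain ⟨b, hb, hbe⟩ := exists_hasDerivAt_eq_slope _ _ (by linarith : a < a + t)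
    (fun x hx => (hψ x hx).continuousAt.continuousWithinAt)
    (fun x hx => hψ x (Ioo_subset_Icc_self hx))
  have hχ : ∀ x ∈ Icc b (b + t), HasDerivAt g₂ (g₃ x) x := fun x hx =>
    h₃ x ⟨by linarith [hx.1, hb.1, ha.1], by linarith [hx.2, hb.2, ha.2]⟩
  obtain ⟨c, hc, hce⟩ := exists_hasDerivAt_eq_slope _ _ (by linarith : b < b + t)
    (fun x hx => (hχ x hx).continuousAt.continuousWithinAt)
    (fun x hx => hχ x (Ioo_subset_Icc_self hx))
  refine ⟨c, ⟨by linarith [hc.1, hb.1, ha.1], by linarith [hc.2, hb.2, ha.2]⟩, ?_⟩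
  have e1 : a + t + t = a + 2 * t := by ring
  have e2 : t + 2 * t = 3 * t := by ring
  have e3 : t + t = 2 * t := by ring
  have e4 : 2 * t + 2 * t = 4 * t := by ring
  have e5 : 2 * t + t = 3 * t := by ring
  have e6 : 2 * t - t = t := by ring
  simp only [add_sub_cancel_left, e1, e2, e3, e4, e5, e6] at hae hbe hce
  have ht0 := ht.ne'
  rw [eq_div_iff ht0] at hae hbe hce
  linear_combination (-t ^ 2) * hce - t * hbe - hae

theorem exists_eq_const_of_hasDerivAt_zero {F : ℝ → ℂ} {r : ℝ}
    (h : ∀ t ∈ Ioo 0 r, HasDerivAt F 0 t) : ∃ K, ∀ t ∈ Ioo 0 r, F t = K :=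
  isOpen_Ioo.exists_is_const_of_deriv_eq_zero isPreconnected_Ioo
    (fun t ht => (h t ht).differentiableAt.differentiableWithinAt) fun t ht => (h t ht).deriv

theorem eq_zero_of_norm_le_mul {K : ℂ} {A r : ℝ} (hr : 0 < r)
    (h : ∀ t ∈ Ioo 0 r, ‖K‖ ≤ A * t) : K = 0 := by
  have hlim : Tendsto (fun t : ℝ => A * t) (𝓝[>] 0) (𝓝 (A * 0)) :=
    ((continuous_const.mul continuous_id).tendsto 0).mono_left nhdsWithin_le_nhds
  rw [mul_zero] at hlim
  exact norm_le_zero_iff.1 (ge_of_tendsto hlim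
    (by filter_upwards [Ioo_mem_nhdsGT hr] with t ht using h t ht))

/-- The coefficients are peeled off in increasing order: divide by the next power of `t` and let `t
→ 0`. -/
theorem quadratic_coeff_eq_zero {a₀ a₁ a₂ : ℂ} {B r : ℝ} (hr : 0 < r) (hr1 : r ≤ 1)
    (h : ∀ t ∈ Ioo 0 r, ‖a₀ + a₁ * t + a₂ * t ^ 2‖ ≤ B * t ^ 3) : a₀ = 0 ∧ a₁ = 0 ∧ a₂ = 0 := by
  have hn : ∀ t ∈ Ioo 0 r, ‖(t : ℂ)‖ = t := fun t ht => by simp [abs_of_pos ht.1]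
  have hB : 0 ≤ B := by
    have := (norm_nonneg _).trans (h (r / 2) ⟨by linarith, by linarith⟩)
    exact nonneg_of_mul_nonneg_left this (by positivity)
  have h0 : a₀ = 0 := by
    refine eq_zero_of_norm_le_mul (A := B + ‖a₁‖ + ‖a₂‖) hr fun t ht => ?_
    have e : a₀ = a₀ + a₁ * t + a₂ * t ^ 2 - a₁ * t - a₂ * t ^ 2 := by ring
    have e1 := norm_sub_le (a₀ + a₁ * t + a₂ * t ^ 2 - a₁ * t) (a₂ * t ^ 2)
    have e2 := norm_sub_le (a₀ + a₁ * t + a₂ * t ^ 2) (a₁ * t)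
    rw [← e] at e1
    rw [norm_mul, norm_pow, hn t ht] at e1
    rw [norm_mul, hn t ht] at e2
    have t2 : t ^ 2 ≤ t := by nlinarith [ht.1, ht.2]
    have t3 : t ^ 3 ≤ t := by nlinarith [ht.1, ht.2]
    nlinarith [h t ht, norm_nonneg a₂, mul_le_mul_of_nonneg_left t3 hB,
      mul_le_mul_of_nonneg_left t2 (norm_nonneg a₂)]
  have h1 : a₁ = 0 := by
    refine eq_zero_of_norm_le_mul (A := B + ‖a₂‖) hr fun t ht => ?_
    have e : a₁ * t = a₀ + a₁ * t + a₂ * t ^ 2 - a₂ * t ^ 2 := by rw [h0]; ring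
    have e1 := norm_sub_le (a₀ + a₁ * t + a₂ * t ^ 2) (a₂ * t ^ 2)
    rw [← e] at e1
    rw [norm_mul, norm_mul, norm_pow, hn t ht] at e1
    have t3 : t ^ 3 ≤ t ^ 2 := by nlinarith [ht.1, ht.2, sq_nonneg t]
    refine le_of_mul_le_mul_right ?_ ht.1
    nlinarith [h t ht, mul_le_mul_of_nonneg_left t3 hB]
  refine ⟨h0, h1, eq_zero_of_norm_le_mul (A := B) hr fun t ht => ?_⟩
  have e := h t ht
  rw [h0, h1, zero_mul, zero_add, zero_add, norm_mul, norm_pow, hn t ht] at e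
  refine le_of_mul_le_mul_right ?_ (pow_pos ht.1 2)
  linarith

/-! ### Every solution gives a fixed point on a real segment. -/

section
variable {g g₁ g₂ g₃ : ℝ → ℝ} {y₀ C B r : ℝ}

/-- Integration of the flux equation: its constant vanishes by third differences. -/
theorem flux_integral_eq_zero (hy₀ : 0 < y₀) (hC : 0 < C) (hr : SmallRadius y₀ C r)
    (h₁ : ∀ t ∈ Ioo 0 r, HasDerivAt g (g₁ t) t) (h₂ : ∀ t ∈ Ioo 0 r, HasDerivAt g₁ (g₂ t) t)
    (h₃ : ∀ t ∈ Ioo 0 r, HasDerivAt g₂ (g₃ t) t)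
    (hJ : ∀ t ∈ Ioo 0 r,
      HasDerivAt (fun t => g t * (2 - g t) * g₃ t) (-((y₀ - t) * g₁ t / 4)) t)
    (hB : ∀ t ∈ Ioo 0 r, |g t - C * t ^ 2| ≤ B * t ^ 3) (hB0 : 0 ≤ B) {γ : ℂ → ℂ}
    (hγ : ContBoundedOn (Complex.ofReal '' Ioo 0 r) (3 * C / 2) γ)
    (hgγ : ∀ t ∈ Ioo 0 r, (g t : ℂ) = t ^ 2 * γ t) :
    ∀ t ∈ Ioo 0 r, ((g t * (2 - g t) * g₃ t + (y₀ - t) * g t / 4 : ℝ) : ℂ)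
      + t ^ 3 * radialMoment 2 γ t / 4 = 0 := by
  obtain ⟨K, hK⟩ := exists_eq_const_of_hasDerivAt_zero (r := r)
    (F := fun t => ((g t * (2 - g t) * g₃ t + (y₀ - t) * g t / 4 : ℝ) : ℂ)
      + t ^ 3 * radialMoment 2 γ t / 4) (by
    intro t ht
    have e1 := ((hJ t ht).add ((((hasDerivAt_id t).const_sub y₀).mul (h₁ t ht)).div_const 4)).ofReal_comp
    have e2 := (hasDerivAt_radialMoment hγ 2 ht).div_const 4
    refine (e1.add e2).congr_deriv ?_
    rw [← hgγ t ht]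
    push_cast
    simp only [id]
    ring)
  have hgb : ∀ t ∈ Ioo 0 r, ‖(g t : ℂ)‖ ≤ 3 * C / 2 * t ^ 2 := by
    intro t ht
    rw [hgγ t ht, norm_mul, norm_pow, Complex.norm_real, Real.norm_eq_abs, abs_of_pos ht.1,
      mul_comm]
    exact mul_le_mul_of_nonneg_right (hγ.bound _ ⟨t, ht, rfl⟩) (sq_nonneg t)
  -- No bound on `g₃` near `0` is known beforehand, but the expression is constant, so smallness at
  -- points `ξ → 0` with `g₃ ξ` bounded suffices.
  have hK0 : K = 0 := by
    -- All three terms are bounded by multiples of `ξ`, and `ξ < 4 t`; the range `r / 4` keeps `4 t`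
    -- below `r`.
    refine eq_zero_of_norm_le_mul (A := 4 * (3 * C / 2 * (3 * (170 * B) + (y₀ + 1) + 1)))
      (r := r / 4) (by linarith [hr.pos]) fun t ht => ?_
    obtain ⟨ξ, hξ, hξe⟩ := exists_third_difference_eq h₁ h₂ h₃ ht.1 (by linarith [ht.2])
    have hξr : ξ ∈ Ioo 0 r := ⟨ht.1.trans hξ.1, by linarith [hξ.2, ht.2]⟩
    -- The term `C t²` drops out of the third difference, and `170 = 4³ + 3 · 3³ + 3 · 2³ + 1`.
    have hg3 : |g₃ ξ| ≤ 170 * B := by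
      have b1 := abs_le.1 (hB t ⟨ht.1, by linarith [ht.1, ht.2]⟩)
      have b2 := abs_le.1 (hB (2 * t) ⟨by linarith [ht.1], by linarith [ht.1, ht.2]⟩)
      have b3 := abs_le.1 (hB (3 * t) ⟨by linarith [ht.1], by linarith [ht.1, ht.2]⟩)
      have b4 := abs_le.1 (hB (4 * t) ⟨by linarith [ht.1], by linarith [ht.1, ht.2]⟩)
      have ht3 : 0 < t ^ 3 := pow_pos ht.1 3
      rw [abs_le]
      constructor
      · refine le_of_mul_le_mul_left ?_ ht3
        rw [← hξe]
        nlinarith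
      · refine le_of_mul_le_mul_left ?_ ht3
        rw [← hξe]
        nlinarith
    have hξ1 : ξ ≤ 1 := hξr.2.le.trans hr.le_one
    have hgξ := hgb ξ hξr
    rw [Complex.norm_real, Real.norm_eq_abs] at hgξ
    have hξ2 : ξ ^ 2 ≤ ξ := by nlinarith [hξr.1]
    have hgξ' : |g ξ| ≤ 3 * C / 2 * ξ :=
      hgξ.trans (mul_le_mul_of_nonneg_left hξ2 (by linarith))
    have hg1 : |g ξ| ≤ 1 := hgξ'.trans (by nlinarith [hr.mul_C_le, hξr.2])
    have h2g : |2 - g ξ| ≤ 3 := by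
      rw [abs_le] at hg1 ⊢
      constructor <;> linarith [hg1.1, hg1.2]
    have hyξ : |y₀ - ξ| ≤ y₀ + 1 := by
      rw [abs_le]
      constructor <;> linarith [hξr.1]
    have hX : 0 ≤ 3 * C / 2 * ξ := by have := hξr.1; positivity
    have n1 : |g ξ * (2 - g ξ) * g₃ ξ| ≤ 3 * C / 2 * ξ * (3 * (170 * B)) := by
      rw [abs_mul, abs_mul, mul_assoc]
      exact mul_le_mul hgξ' (mul_le_mul h2g hg3 (abs_nonneg _) (by norm_num))
        (by positivity) hX
    have n2 : |(y₀ - ξ) * g ξ / 4| ≤ 3 * C / 2 * ξ * (y₀ + 1) := by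
      rw [abs_div, abs_mul, abs_of_pos (by norm_num : (0 : ℝ) < 4)]
      have := mul_le_mul hyξ hgξ' (abs_nonneg _) (by linarith)
      have h0 := mul_nonneg (abs_nonneg (y₀ - ξ)) (abs_nonneg (g ξ))
      linarith
    have n3 : ‖(ξ : ℂ) ^ 3 * radialMoment 2 γ ξ / 4‖ ≤ 3 * C / 2 * ξ := by
      have h4 : ‖(4 : ℂ)‖ = 4 := by simp
      rw [norm_div, norm_mul, norm_pow, Complex.norm_real, Real.norm_eq_abs, abs_of_pos hξr.1, h4]
      have hm := norm_radialMoment_le (isRadial_segment r) hγ.bound 2 (z := ξ) ⟨ξ, hξr, rfl⟩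
      have hξ3 : ξ ^ 3 ≤ ξ := by nlinarith [hξr.1]
      have := mul_le_mul hξ3 hm (norm_nonneg _) hξr.1.le
      have h0 := mul_nonneg (pow_pos hξr.1 3).le (norm_nonneg (radialMoment 2 γ ξ))
      linarith
    rw [← hK ξ hξr]
    refine (norm_add_le _ _).trans ?_
    rw [Complex.norm_real, Real.norm_eq_abs]
    have n4 := abs_add_le (g ξ * (2 - g ξ) * g₃ ξ) ((y₀ - ξ) * g ξ / 4)
    have hA : 0 ≤ 3 * C / 2 * (3 * (170 * B) + (y₀ + 1) + 1) := by positivity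
    have := mul_le_mul_of_nonneg_left hξ.2.le hA
    linarith
  intro t ht
  rw [hK t ht, hK0]

/-- A real function is recovered from its third derivative and its expansion at `0`. -/
theorem eq_sq_mul_quotientOfThirdDeriv {M : ℝ} (hr0 : 0 < r) (hr1 : r ≤ 1)
    (h₁ : ∀ t ∈ Ioo 0 r, HasDerivAt g (g₁ t) t) (h₂ : ∀ t ∈ Ioo 0 r, HasDerivAt g₁ (g₂ t) t)
    (h₃ : ∀ t ∈ Ioo 0 r, HasDerivAt g₂ (g₃ t) t)
    (hB : ∀ t ∈ Ioo 0 r, |g t - C * t ^ 2| ≤ B * t ^ 3) {w : ℂ → ℂ}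
    (hw : ContBoundedOn (Complex.ofReal '' Ioo 0 r) M w)
    (hg₃ : ∀ t ∈ Ioo 0 r, (g₃ t : ℂ) = w t) :
    ∀ t ∈ Ioo 0 r, (g t : ℂ) = t ^ 2 * quotientOfThirdDeriv C w t := by
  have hS := isRadial_segment r
  have hw0 := hw.radialMoment hS 0
  have hw1 := hw0.radialMoment hS 1
  have hw2 := hw1.radialMoment hS 2
  obtain ⟨a₂, ha₂⟩ := exists_eq_const_of_hasDerivAt_zero (r := r)
    (F := fun t => (g₂ t : ℂ) - (t : ℂ) ^ (0 + 1) * radialMoment 0 w t) (by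
    intro t ht
    refine ((h₃ t ht).ofReal_comp.sub (hasDerivAt_radialMoment hw 0 ht)).congr_deriv ?_
    rw [hg₃ t ht]
    ring)
  have hid : ∀ t : ℝ, HasDerivAt (fun t : ℝ => (t : ℂ)) 1 t := fun t => by
    simpa using (hasDerivAt_id t).ofReal_comp
  obtain ⟨a₁, ha₁⟩ := exists_eq_const_of_hasDerivAt_zero (r := r)
    (F := fun t => (g₁ t : ℂ) - (t : ℂ) ^ (1 + 1) * radialMoment 1 (radialMoment 0 w) t
      - a₂ * t) (by
    intro t ht
    refine (((h₂ t ht).ofReal_comp.sub (hasDerivAt_radialMoment hw0 1 ht)).sub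
      ((hid t).const_mul a₂)).congr_deriv ?_
    rw [← ha₂ t ht]
    ring)
  obtain ⟨a₀, ha₀⟩ := exists_eq_const_of_hasDerivAt_zero (r := r)
    (F := fun t => (g t : ℂ)
      - (t : ℂ) ^ (2 + 1) * radialMoment 2 (radialMoment 1 (radialMoment 0 w)) t
      - a₂ / 2 * t ^ 2 - a₁ * t) (by
    intro t ht
    refine ((((h₁ t ht).ofReal_comp.sub (hasDerivAt_radialMoment hw1 2 ht)).sub
      (((hid t).pow 2).const_mul (a₂ / 2))).sub ((hid t).const_mul a₁)).congr_deriv ?_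
    rw [← ha₁ t ht]
    push_cast
    ring)
  -- The polynomial left by the three integrations, minus `C t²`, is `O(t³)`: `B` comes from the
  -- expansion, `M` from the triple integral.
  obtain ⟨e0, e1, e2⟩ := quadratic_coeff_eq_zero (a₀ := a₀) (a₁ := a₁) (a₂ := a₂ / 2 - C)
    (B := B + M) hr0 hr1 (by
    intro t ht
    have e : a₀ + a₁ * t + (a₂ / 2 - C) * t ^ 2 = ((g t - C * t ^ 2 : ℝ) : ℂ)
        - (t : ℂ) ^ 3 * radialMoment 2 (radialMoment 1 (radialMoment 0 w)) t := by
      rw [← ha₀ t ht]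
      push_cast
      ring
    rw [e]
    refine (norm_sub_le _ _).trans ?_
    rw [Complex.norm_real, Real.norm_eq_abs, norm_mul, norm_pow, Complex.norm_real,
      Real.norm_eq_abs, abs_of_pos ht.1]
    have := mul_le_mul_of_nonneg_left (hw2.bound t ⟨t, ht, rfl⟩) (pow_pos ht.1 3).le
    linarith [hB t ht])
  intro t ht
  have h := ha₀ t ht
  simp only [e0, e1] at h
  rw [quotientOfThirdDeriv]
  linear_combination h + (t : ℂ) ^ 2 * e2

/-- The integrated flux equation computes `g'''` from `γ = g / t²`, and integrating `g'''` back
returns `γ`; applying the first formula again gives the fixed-point identity. -/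
theorem profileMap_fixedPoint_of_solution (hy₀ : 0 < y₀) (hC : 0 < C) (hr : SmallRadius y₀ C r)
    (h₁ : ∀ t ∈ Ioo 0 r, HasDerivAt g (g₁ t) t) (h₂ : ∀ t ∈ Ioo 0 r, HasDerivAt g₁ (g₂ t) t)
    (h₃ : ∀ t ∈ Ioo 0 r, HasDerivAt g₂ (g₃ t) t)
    (hJ : ∀ t ∈ Ioo 0 r,
      HasDerivAt (fun t => g t * (2 - g t) * g₃ t) (-((y₀ - t) * g₁ t / 4)) t)
    (hB : ∀ t ∈ Ioo 0 r, |g t - C * t ^ 2| ≤ B * t ^ 3) (hB0 : 0 ≤ B) (hBr : B * r ≤ C / 2) :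
    ∃ w : ℂ → ℂ, ContBoundedOn (Complex.ofReal '' Ioo 0 r) (y₀ + 4) w ∧
      EqOn (profileMap y₀ C w) w (Complex.ofReal '' Ioo 0 r) ∧
      ∀ t ∈ Ioo 0 r, (g t : ℂ) = t ^ 2 * quotientOfThirdDeriv C w t := by
  have hS := isRadial_segment r
  have hSr : ∀ z ∈ Complex.ofReal '' Ioo 0 r, ‖z‖ < r := by
    rintro _ ⟨t, ht, rfl⟩
    rw [Complex.norm_real, Real.norm_eq_abs, abs_of_pos ht.1]
    exact ht.2
  let γ : ℂ → ℂ := fun z => ((g z.re / z.re ^ 2 : ℝ) : ℂ)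
  have hgγ : ∀ t ∈ Ioo 0 r, (g t : ℂ) = t ^ 2 * γ t := by
    intro t ht
    have : (t : ℂ) ≠ 0 := Complex.ofReal_ne_zero.2 ht.1.ne'
    simp only [γ, Complex.ofReal_re]
    push_cast
    field_simp
  have hγC : ∀ z ∈ Complex.ofReal '' Ioo 0 r, ‖γ z - C‖ ≤ C / 2 := by
    rintro _ ⟨t, ht, rfl⟩
    have ht2 : 0 < t ^ 2 := pow_pos ht.1 2
    simp only [γ, Complex.ofReal_re]
    rw [← Complex.ofReal_sub, Complex.norm_real, Real.norm_eq_abs]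
    have e : g t / t ^ 2 - C = (g t - C * t ^ 2) / t ^ 2 := by
      rw [sub_div, mul_div_cancel_right₀ _ ht2.ne']
    rw [e, abs_div, abs_of_pos ht2, div_le_iff₀ ht2]
    refine (hB t ht).trans ?_
    have : B * t ≤ C / 2 := (mul_le_mul_of_nonneg_left ht.2.le hB0).trans hBr
    nlinarith
  have hγc : ContinuousOn γ (Complex.ofReal '' Ioo 0 r) := by
    have hg : ContinuousOn (fun t => g t / t ^ 2) (Ioo 0 r) := by
      refine ContinuousOn.div (fun t ht => (h₁ t ht).continuousAt.continuousWithinAt)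
        (by fun_prop) fun t ht => (pow_pos ht.1 2).ne'
    refine Complex.continuous_ofReal.comp_continuousOn
      (hg.comp Complex.continuous_re.continuousOn ?_)
    rintro _ ⟨t, ht, rfl⟩
    simpa using ht
  have hγ := ContBoundedOn.of_norm_sub_le hC hγc hγC
  have hflux := flux_integral_eq_zero hy₀ hC hr h₁ h₂ h₃ hJ hB hB0 hγ hgγ
  have hw := thirdDerivOfQuotient_contBoundedOn hy₀ hC hr hS hSr hγc hγC
  have hg₃ : ∀ t ∈ Ioo 0 r, (g₃ t : ℂ) = thirdDerivOfQuotient y₀ γ t := by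
    intro t ht
    have ht0 : (t : ℂ) ≠ 0 := Complex.ofReal_ne_zero.2 ht.1.ne'
    have hz : (t : ℂ) ∈ Complex.ofReal '' Ioo 0 r := ⟨t, ht, rfl⟩
    have hγ0 : γ t ≠ 0 := norm_pos_iff.1
      ((half_pos hC).trans_le (norm_bounds_of_norm_sub_le hC (hγC t hz)).1)
    have hd0 : 2 - (t : ℂ) ^ 2 * γ t ≠ 0 := norm_pos_iff.1
      (zero_lt_one.trans_le (hr.norm_two_sub hC (hSr t hz) (hγC t hz)))
    have h := hflux t ht
    push_cast at h
    rw [hgγ t ht] at h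
    rw [thirdDerivOfQuotient, eq_div_iff (mul_ne_zero (by norm_num) hd0)]
    refine mul_left_cancel₀ (mul_ne_zero (pow_ne_zero 2 ht0) hγ0) ?_
    have hc : γ t * (radialMoment 2 γ t / γ t) = radialMoment 2 γ t := mul_div_cancel₀ _ hγ0
    linear_combination 4 * h + (t : ℂ) ^ 3 * hc
  have hg := eq_sq_mul_quotientOfThirdDeriv hr.pos hr.le_one h₁ h₂ h₃ hB hw hg₃
  have heq : EqOn (quotientOfThirdDeriv C (thirdDerivOfQuotient y₀ γ)) γ
      (Complex.ofReal '' Ioo 0 r) := by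
    rintro _ ⟨t, ht, rfl⟩
    have ht0 : (t : ℂ) ≠ 0 := Complex.ofReal_ne_zero.2 ht.1.ne'
    refine mul_left_cancel₀ (pow_ne_zero 2 ht0) ?_
    rw [← hg t ht, hgγ t ht]
  refine ⟨thirdDerivOfQuotient y₀ γ, hw, fun z hz => ?_, hg⟩
  simp only [profileMap, thirdDerivOfQuotient]
  have := radialMoment_congr hS heq 2 hz
  have h2 := heq hz
  rw [this, h2]

end

/-! ### The profile of the fixed point: uniqueness, analyticity, equation, expansion. -/

theorem hasDerivAt_iterated_of_contDiffOn {f : ℝ → ℝ} {a b : ℝ}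
    (h : ContDiffOn ℝ 3 f (Ioo a b)) {y : ℝ} (hy : y ∈ Ioo a b) :
    HasDerivAt f (deriv f y) y ∧ HasDerivAt (deriv f) (deriv (deriv f) y) y ∧
      HasDerivAt (deriv (deriv f)) (iteratedDeriv 3 f y) y := by
  have h3 := (contDiffOn_succ_iff_deriv_of_isOpen (n := 2) isOpen_Ioo).1 h
  have h2 := (contDiffOn_succ_iff_deriv_of_isOpen (n := 1) isOpen_Ioo).1 h3.2.2
  have h1 := (contDiffOn_succ_iff_deriv_of_isOpen (n := 0) isOpen_Ioo).1 h2.2.2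
  have hn := isOpen_Ioo.mem_nhds hy
  rw [iteratedDeriv_eq_iterate]
  exact ⟨(h3.1.differentiableAt hn).hasDerivAt, (h2.1.differentiableAt hn).hasDerivAt,
    (h1.1.differentiableAt hn).hasDerivAt⟩

theorem iteratedDeriv_three_eq {f f₁ f₂ f₃ : ℝ → ℝ} {s : Set ℝ} (hs : IsOpen s)
    (h₁ : ∀ y ∈ s, HasDerivAt f (f₁ y) y) (h₂ : ∀ y ∈ s, HasDerivAt f₁ (f₂ y) y)
    (h₃ : ∀ y ∈ s, HasDerivAt f₂ (f₃ y) y) : EqOn (iteratedDeriv 3 f) f₃ s := by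
  have step : ∀ {p q q' : ℝ → ℝ}, EqOn p q s → (∀ y ∈ s, HasDerivAt q (q' y) y) →
      EqOn (deriv p) q' s := fun hpq hq y hy =>
    (((hpq.eventuallyEq_of_mem (hs.mem_nhds hy)).deriv_eq).trans (hq y hy).deriv)
  rw [iteratedDeriv_eq_iterate]
  exact step (step (step (eqOn_refl f s) h₁) h₂) h₃

theorem HasDerivAt.re_of_real {F : ℝ → ℂ} {F' : ℂ} {t : ℝ} (h : HasDerivAt F F' t) :
    HasDerivAt (fun t => (F t).re) F'.re t :=
  Complex.reCLM.hasFDerivAt.comp_hasDerivAt t h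

/-- The profile `1 - g(y₀ - y)` whose third derivative in `t = y₀ - y` is `w`. -/
noncomputable def profileOfThirdDeriv (y₀ C : ℝ) (w : ℂ → ℂ) (y : ℝ) : ℝ :=
  1 - (((y₀ - y : ℝ) : ℂ) ^ 2 * quotientOfThirdDeriv C w ((y₀ - y : ℝ) : ℂ)).re

section
variable {y₀ C r δ : ℝ} {w : ℂ → ℂ} {f : ℝ → ℝ}

theorem ContBoundedOn.segment {M : ℝ} (h : ContBoundedOn (Metric.ball 0 r) M w) :
    ContBoundedOn (Complex.ofReal '' Ioo 0 r) M w := by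
  have hsub : Complex.ofReal '' Ioo 0 r ⊆ Metric.ball 0 r := by
    rintro _ ⟨t, ht, rfl⟩
    rw [mem_ball_zero_iff, Complex.norm_real, Real.norm_eq_abs, abs_of_pos ht.1]
    exact ht.2
  exact ⟨h.cont.mono hsub, fun z hz => h.bound z (hsub hz)⟩

theorem eventually_eq_profileOfThirdDeriv (hy₀ : 0 < y₀) (hC : 0 < C) (hr : SmallRadius y₀ C r)
    (hw : ContBoundedOn (Metric.ball 0 r) (y₀ + 4) w)
    (hfix : EqOn (profileMap y₀ C w) w (Metric.ball 0 r)) (hf : IsLocalFBSolution y₀ C δ f) :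
    ∀ᶠ y in 𝓝[<] y₀, f y = profileOfThirdDeriv y₀ C w y := by
  obtain ⟨B, hB0, hB⟩ := hf.expansion.exists_pos
  obtain ⟨l, hl, hlB⟩ := (mem_nhdsLT_iff_exists_Ioo_subset).1 hB.bound
  rw [mem_Iio] at hl
  -- The four bounds ensure, in order: contraction, validity of the equation, validity of the
  -- expansion estimate, and `g / t²` within `C / 2` of `C`.
  obtain ⟨ρ, hρ⟩ : ∃ ρ, ρ = min (min r δ) (min (y₀ - l) (C / 2 / B)) := ⟨_, rfl⟩
  have hρ0 : 0 < ρ := by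
    have h1 := hr.pos
    have h2 := hf.pos
    have h3 : 0 < y₀ - l := by linarith
    rw [hρ]
    positivity
  have hρr : ρ ≤ r := hρ ▸ (min_le_left _ _).trans (min_le_left _ _)
  have hρδ : ρ ≤ δ := hρ ▸ (min_le_left _ _).trans (min_le_right _ _)
  have hρl : ρ ≤ y₀ - l := hρ ▸ (min_le_right _ _).trans (min_le_left _ _)
  have hρB : ρ ≤ C / 2 / B := hρ ▸ (min_le_right _ _).trans (min_le_right _ _)
  have hsr := hr.mono hy₀ hC hρ0 hρr
  have hmem : ∀ t ∈ Ioo 0 ρ, y₀ - t ∈ Ioo (y₀ - δ) y₀ := fun t ht =>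
    ⟨by linarith [ht.2], by linarith [ht.1]⟩
  have hd := fun t ht => hasDerivAt_iterated_of_contDiffOn hf.solution.contDiffOn (hmem t ht)
  obtain ⟨v, hv, hvfix, hvf⟩ := profileMap_fixedPoint_of_solution (g := fun t => 1 - f (y₀ - t))
    (g₁ := fun t => deriv f (y₀ - t)) (g₂ := fun t => -deriv (deriv f) (y₀ - t))
    (g₃ := fun t => iteratedDeriv 3 f (y₀ - t)) (B := B) hy₀ hC hsr
    (fun t ht => by
      simpa using ((hd t ht).1.comp_const_sub y₀ t).const_sub 1)
    (fun t ht => (hd t ht).2.1.comp_const_sub y₀ t)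
    (fun t ht => ((hd t ht).2.2.comp_const_sub y₀ t).neg.congr_deriv (neg_neg _))
    (fun t ht => by
      have e := ((hf.solution.differentiable_flux _ (hmem t ht)).hasDerivAt).comp_const_sub y₀ t
      have e' := hf.solution.equation _ (hmem t ht)
      refine (e.congr_deriv (by linarith)).congr_of_eventuallyEq (Eventually.of_forall fun x => ?_)
      simp only [thinFilmFlux]
      ring)
    (fun t ht => by
      have e := hlB (show y₀ - t ∈ Ioo l y₀ from ⟨by linarith [ht.2], by linarith [ht.1]⟩)
      simp only [mem_ofPred_eq, sub_sub_cancel, Real.norm_eq_abs, abs_pow, abs_of_pos ht.1] at e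
      rw [← abs_neg]
      convert e using 2
      ring)
    hB0.le (by rw [mul_comm]; exact (le_div_iff₀ hB0).1 hρB)
  have hsub : Complex.ofReal '' Ioo 0 ρ ⊆ Metric.ball 0 r := by
    rintro _ ⟨t, ht, rfl⟩
    rw [mem_ball_zero_iff, Complex.norm_real, Real.norm_eq_abs, abs_of_pos ht.1]
    exact ht.2.trans_le hρr
  have hS := isRadial_segment ρ
  have hvw : EqOn v w (Complex.ofReal '' Ioo 0 ρ) :=
    profileMap_fixedPoint_unique hy₀ hC hsr hS
      (by
        rintro _ ⟨t, ht, rfl⟩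
        rw [Complex.norm_real, Real.norm_eq_abs, abs_of_pos ht.1]
        exact ht.2)
      hv ⟨hw.cont.mono hsub, fun z hz => hw.bound z (hsub hz)⟩ hvfix
      fun z hz => hfix (hsub hz)
  have hcongr := radialMoment_congr hS (radialMoment_congr hS (radialMoment_congr hS hvw 0) 1) 2
  filter_upwards [Ioo_mem_nhdsLT (show y₀ - ρ < y₀ by linarith)] with y hy
  have ht : y₀ - y ∈ Ioo 0 ρ := ⟨by linarith [hy.2], by linarith [hy.1]⟩
  have e := hvf _ ht
  have e2 := hcongr (mem_image_of_mem Complex.ofReal ht)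
  simp only [quotientOfThirdDeriv] at e
  rw [e2, sub_sub_cancel] at e
  rw [profileOfThirdDeriv, quotientOfThirdDeriv, ← e, Complex.ofReal_re]
  ring

theorem analyticAt_profileOfThirdDeriv (h : DifferentiableOn ℂ w (Metric.ball 0 r)) {y : ℝ}
    (hy : |y₀ - y| < r) : AnalyticAt ℝ (profileOfThirdDeriv y₀ C w) y := by
  have hd : DifferentiableOn ℂ (fun z => z ^ 2 * quotientOfThirdDeriv C w z) (Metric.ball 0 r) :=
    (differentiableOn_id.pow 2).mul (differentiableOn_quotientOfThirdDeriv h)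
  have hz : ((y₀ - y : ℝ) : ℂ) ∈ Metric.ball 0 r := by
    rw [mem_ball_zero_iff, Complex.norm_real, Real.norm_eq_abs]
    exact hy
  have ha := (hd.analyticAt (Metric.isOpen_ball.mem_nhds hz)).restrictScalars (𝕜 := ℝ)
  have hs : AnalyticAt ℝ (fun y : ℝ => ((y₀ - y : ℝ) : ℂ)) y :=
    (Complex.ofRealCLM.analyticAt (y₀ - y)).comp (f := fun y : ℝ => y₀ - y)
      (analyticAt_const.sub analyticAt_id)
  have hc := ha.comp (f := fun y : ℝ => ((y₀ - y : ℝ) : ℂ)) hs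
  exact analyticAt_const.sub ((Complex.reCLM.analyticAt _).comp hc)

theorem quotientOfThirdDeriv_bounds (hr : SmallRadius y₀ C r)
    (hw : ContBoundedOn (Metric.ball 0 r) (y₀ + 4) w)
    (hreal : ∀ t : ℝ, |t| < r → (starRingEnd ℂ) (w t) = w t) {t : ℝ} (ht : t ∈ Ioo 0 r) :
    quotientOfThirdDeriv C w t = ((quotientOfThirdDeriv C w t).re : ℂ) ∧
      C / 2 ≤ (quotientOfThirdDeriv C w t).re ∧ (quotientOfThirdDeriv C w t).re ≤ 3 * C / 2 := by
  have hta : |t| < r := by rw [abs_of_pos ht.1]; exact ht.2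
  have hz : (t : ℂ) ∈ Metric.ball (0 : ℂ) r := by
    rw [mem_ball_zero_iff, Complex.norm_real]; exact hta
  refine ⟨(Complex.conj_eq_iff_re.1 (conj_quotientOfThirdDeriv hreal t hta)).symm, ?_⟩
  have h := (norm_quotientOfThirdDeriv_sub_le hr (isRadial_ball r)
    (fun z hz => mem_ball_zero_iff.1 hz) hw).2 _ hz
  have := abs_le.1 ((Complex.abs_re_le_norm _).trans h)
  rw [Complex.sub_re, Complex.ofReal_re] at this
  constructor <;> linarith [this.1, this.2]

/-- The function `t² u(t)` has third derivative `w` and solves the flux equation when `w` is a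
fixed point. -/
theorem hasDerivAt_of_profileMap_fixedPoint (hC : 0 < C)
    (hr : SmallRadius y₀ C r)
    (hw : ContBoundedOn (Metric.ball 0 r) (y₀ + 4) w)
    (hfix : EqOn (profileMap y₀ C w) w (Metric.ball 0 r))
    (hreal : ∀ t : ℝ, |t| < r → (starRingEnd ℂ) (w t) = w t) :
    ∃ g₁ g₂ : ℝ → ℝ,
      (∀ t ∈ Ioo 0 r, HasDerivAt
        (fun t : ℝ => ((t : ℂ) ^ 2 * quotientOfThirdDeriv C w t).re) (g₁ t) t) ∧
      (∀ t ∈ Ioo 0 r, HasDerivAt g₁ (g₂ t) t) ∧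
      (∀ t ∈ Ioo 0 r, HasDerivAt g₂ (w t).re t) ∧
      (∀ t ∈ Ioo 0 r, HasDerivAt
        (fun t : ℝ => ((t : ℂ) ^ 2 * quotientOfThirdDeriv C w t).re
          * (2 - ((t : ℂ) ^ 2 * quotientOfThirdDeriv C w t).re) * (w t).re)
        (-((y₀ - t) * g₁ t / 4)) t) ∧
      ∀ t ∈ Ioo 0 r, |g₁ t - 2 * C * t| ≤ (y₀ + 4) * t ^ 2 := by
  have hS := isRadial_segment r
  have hws := hw.segment
  have hw0 := hws.radialMoment hS 0
  have hw1 := hw0.radialMoment hS 1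
  have hid : ∀ t : ℝ, HasDerivAt (fun t : ℝ => (t : ℂ)) 1 t := fun t => by
    simpa using (hasDerivAt_id t).ofReal_comp
  have h1 : ∀ t ∈ Ioo 0 r, HasDerivAt
      (fun t : ℝ => ((t : ℂ) ^ 2 * quotientOfThirdDeriv C w t).re)
      (2 * C * t + (t : ℂ) ^ (1 + 1) * radialMoment 1 (radialMoment 0 w) t).re t := by
    intro t ht
    have e := (((hid t).pow 2).const_mul (C : ℂ)).add (hasDerivAt_radialMoment hw1 2 ht)
    refine ((e.re_of_real).congr_deriv ?_).congr_of_eventuallyEq (Eventually.of_forall fun x => ?_)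
    · congr 1
      push_cast
      ring
    · simp only [quotientOfThirdDeriv, Pi.add_apply, Pi.pow_apply]
      congr 1
      ring
  refine ⟨_, fun t => (2 * C + (t : ℂ) ^ (0 + 1) * radialMoment 0 w t).re, h1, ?_, ?_, ?_, ?_⟩
  · intro t ht
    have e := ((hid t).const_mul (2 * C : ℂ)).add (hasDerivAt_radialMoment hw0 1 ht)
    refine e.re_of_real.congr_deriv ?_
    congr 1
    ring
  · intro t ht
    refine ((hasDerivAt_radialMoment hws 0 ht).const_add (2 * C : ℂ)).re_of_real.congr_deriv ?_
    rw [pow_zero, one_mul]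
  · have hSr : ∀ z ∈ Complex.ofReal '' Ioo 0 r, ‖z‖ < r := by
      rintro _ ⟨t, ht, rfl⟩
      rw [Complex.norm_real, Real.norm_eq_abs, abs_of_pos ht.1]
      exact ht.2
    have hu := norm_quotientOfThirdDeriv_sub_le hr hS hSr hws
    have hub := ContBoundedOn.of_norm_sub_le hC hu.1 hu.2
    have hg : ∀ t ∈ Ioo 0 r, ((((t : ℂ) ^ 2 * quotientOfThirdDeriv C w t).re : ℝ) : ℂ)
        = (t : ℂ) ^ 2 * quotientOfThirdDeriv C w t := by
      intro t ht
      rw [(quotientOfThirdDeriv_bounds hr hw hreal ht).1, ← Complex.ofReal_pow,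
        ← Complex.ofReal_mul, Complex.ofReal_re]
    -- The fixed-point identity, multiplied by `t² u (2 - t² u)`, presents the flux as an explicit
    -- primitive, so it is differentiated without differentiating `w`.
    have hflux : ∀ t ∈ Ioo 0 r, ((t : ℂ) ^ 2 * quotientOfThirdDeriv C w t).re
        * (2 - ((t : ℂ) ^ 2 * quotientOfThirdDeriv C w t).re) * (w t).re
        = (-((((y₀ - t) * ((t : ℂ) ^ 2 * quotientOfThirdDeriv C w t).re : ℝ) : ℂ)
          + (t : ℂ) ^ (2 + 1) * radialMoment 2 (quotientOfThirdDeriv C w) t) / 4).re := by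
      intro t ht
      rw [← Complex.ofReal_re (((t : ℂ) ^ 2 * quotientOfThirdDeriv C w t).re
        * (2 - ((t : ℂ) ^ 2 * quotientOfThirdDeriv C w t).re) * (w t).re)]
      congr 1
      have hta : |t| < r := by rw [abs_of_pos ht.1]; exact ht.2
      have hz : (t : ℂ) ∈ Complex.ofReal '' Ioo 0 r := ⟨t, ht, rfl⟩
      have hzb : (t : ℂ) ∈ Metric.ball (0 : ℂ) r := mem_ball_zero_iff.2 (hSr _ hz)
      have hwr : (((w t).re : ℝ) : ℂ) = w t := Complex.conj_eq_iff_re.1 (hreal t hta)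
      push_cast
      rw [hg t ht, hwr]
      have hf := hfix hzb
      have hu0 : quotientOfThirdDeriv C w t ≠ 0 := norm_pos_iff.1
        ((half_pos hC).trans_le (norm_bounds_of_norm_sub_le hC (hu.2 _ hz)).1)
      have hd0 : 2 - (t : ℂ) ^ 2 * quotientOfThirdDeriv C w t ≠ 0 := norm_pos_iff.1
        (zero_lt_one.trans_le (hr.norm_two_sub hC (hSr _ hz) (hu.2 _ hz)))
      rw [profileMap, thirdDerivOfQuotient, div_eq_iff (mul_ne_zero (by norm_num) hd0)] at hf
      have hc : quotientOfThirdDeriv C w t * (radialMoment 2 (quotientOfThirdDeriv C w) t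
        / quotientOfThirdDeriv C w t) = radialMoment 2 (quotientOfThirdDeriv C w) t :=
        mul_div_cancel₀ _ hu0
      linear_combination (-(t : ℂ) ^ 2 * quotientOfThirdDeriv C w t / 4) * hf
        - ((t : ℂ) ^ 3 / 4) * hc
    intro t ht
    have e := (((((hasDerivAt_id t).const_sub y₀).mul (h1 t ht)).ofReal_comp.add
      (hasDerivAt_radialMoment hub 2 ht)).neg.div_const 4).re_of_real
    refine (e.congr_deriv ?_).congr_of_eventuallyEq ?_
    · rw [Complex.div_ofNat_re, Complex.neg_re, Complex.add_re, Complex.ofReal_re]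
      simp only [id]
      ring
    · filter_upwards [isOpen_Ioo.mem_nhds ht] with x hx
      exact hflux x hx
  · intro t ht
    have e : (2 * C * t + (t : ℂ) ^ (1 + 1) * radialMoment 1 (radialMoment 0 w) t).re - 2 * C * t
        = ((t : ℂ) ^ (1 + 1) * radialMoment 1 (radialMoment 0 w) t).re := by
      rw [Complex.add_re]
      simp
    simp only [e]
    refine (Complex.abs_re_le_norm _).trans ?_
    rw [norm_mul, norm_pow, Complex.norm_real, Real.norm_eq_abs, abs_of_pos ht.1, mul_comm]
    exact mul_le_mul_of_nonneg_right (hw1.bound _ ⟨t, ht, rfl⟩) (sq_nonneg t)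

theorem profileOfThirdDeriv_expansion (hr : SmallRadius y₀ C r)
    (hdiff : DifferentiableOn ℂ w (Metric.ball 0 r))
    (hfix : EqOn (profileMap y₀ C w) w (Metric.ball 0 r)) :
    (fun y => profileOfThirdDeriv y₀ C w y - (1 - C * (y₀ - y) ^ 2 + y₀ / 48 * (y₀ - y) ^ 3))
      =O[𝓝 y₀] fun y => (y₀ - y) ^ 4 := by
  have h0 : (0 : ℂ) ∈ Metric.ball (0 : ℂ) r := Metric.mem_ball_self hr.pos
  -- At `z = 0` the fixed-point formula reduces to `-y₀ / (4 · 2)`; the three moments at `0` then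
  -- divide by `1 · 2 · 3`, whence `y₀ / 48`.
  have hw0 : w 0 = -y₀ / 8 := by
    rw [← hfix h0]
    simp only [profileMap, thirdDerivOfQuotient]
    ring
  obtain ⟨V, hV⟩ : ∃ V, V = radialMoment 2 (radialMoment 1 (radialMoment 0 w)) := ⟨_, rfl⟩
  have hV0 : V 0 = -y₀ / 48 := by
    rw [hV, radialMoment_zero_right, radialMoment_zero_right, radialMoment_zero_right, hw0]
    push_cast
    ring
  have hVd : DifferentiableAt ℂ V 0 := by
    rw [hV]
    exact (differentiableOn_radialMoment (differentiableOn_radialMoment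
      (differentiableOn_radialMoment hdiff 0) 1) 2).differentiableAt
      (Metric.isOpen_ball.mem_nhds h0)
  have ht : Tendsto (fun y : ℝ => ((y₀ - y : ℝ) : ℂ)) (𝓝 y₀) (𝓝 0) := by
    have : Continuous fun y : ℝ => ((y₀ - y : ℝ) : ℂ) := by fun_prop
    simpa using this.tendsto y₀
  have hO := (hVd.isBigO_sub).comp_tendsto ht
  have hO2 := (isBigO_refl (fun y : ℝ => ((y₀ - y : ℝ) : ℂ) ^ 3) (𝓝 y₀)).mul hO
  have hre : (fun y => profileOfThirdDeriv y₀ C w y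
      - (1 - C * (y₀ - y) ^ 2 + y₀ / 48 * (y₀ - y) ^ 3))
      = fun y : ℝ => -(((y₀ - y : ℝ) : ℂ) ^ 3 * (V ((y₀ - y : ℝ) : ℂ) - V 0)).re := by
    ext y
    have e : ((y₀ - y : ℝ) : ℂ) ^ 2 * quotientOfThirdDeriv C w ((y₀ - y : ℝ) : ℂ)
        = ((C * (y₀ - y) ^ 2 - y₀ / 48 * (y₀ - y) ^ 3 : ℝ) : ℂ)
          + ((y₀ - y : ℝ) : ℂ) ^ 3 * (V ((y₀ - y : ℝ) : ℂ) - V 0) := by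
      rw [quotientOfThirdDeriv, hV0, ← hV]
      push_cast
      ring
    rw [profileOfThirdDeriv, e, Complex.add_re, Complex.ofReal_re]
    ring
  rw [hre]
  refine IsBigO.trans (IsBigO.of_bound 1 (Eventually.of_forall fun y => ?_)) (hO2.trans ?_)
  · rw [one_mul, norm_neg]
    exact Complex.abs_re_le_norm _
  · refine IsBigO.of_bound 1 (Eventually.of_forall fun y => ?_)
    simp only [Function.comp_apply, sub_zero, norm_mul, norm_pow, Complex.norm_real]
    exact le_of_eq (by ring)

end

/-! ### The main theorem. -/

theorem proposition2p2 (y₀ C : ℝ) (hy₀ : 0 < y₀) (hC : 0 < C) :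
    -- the local free-boundary solution exists, with zero contact angle, zero flux, monotonicity
    (∃ (δ : ℝ) (f : ℝ → ℝ), IsLocalFBSolution y₀ C δ f ∧
      StrictMonoOn f (Ioo (y₀ - δ) y₀) ∧
      Tendsto (deriv f) (𝓝[<] y₀) (𝓝 0) ∧
      Tendsto (thinFilmFlux f) (𝓝[<] y₀) (𝓝 0) ∧
      (fun y => f y - (1 - C * (y₀ - y) ^ 2 + y₀ / 48 * (y₀ - y) ^ 3))
        =O[𝓝[<] y₀] fun y => (y₀ - y) ^ 4) ∧
    -- it is unique as a germ to the left of `y₀`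
    (∀ (δ₁ δ₂ : ℝ) (f₁ f₂ : ℝ → ℝ), IsLocalFBSolution y₀ C δ₁ f₁ → IsLocalFBSolution y₀ C δ₂ f₂ →
      ∀ᶠ y in 𝓝[<] y₀, f₁ y = f₂ y) ∧
    -- it is real analytic at `y₀`
    (∀ (δ : ℝ) (f : ℝ → ℝ), IsLocalFBSolution y₀ C δ f →
      ∃ F : ℝ → ℝ, AnalyticAt ℝ F y₀ ∧ ∀ᶠ y in 𝓝[<] y₀, f y = F y) := by
  obtain ⟨r, hr⟩ := exists_smallRadius hy₀ hC
  obtain ⟨w, hdiff, hw, hfix, hreal⟩ := exists_profileMap_fixedPoint hy₀ hC hr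
  have hr0 := hr.pos
  have han : AnalyticAt ℝ (profileOfThirdDeriv y₀ C w) y₀ :=
    analyticAt_profileOfThirdDeriv hdiff (by simpa using hr.pos)
  refine ⟨⟨r, profileOfThirdDeriv y₀ C w, ?_⟩, ?_, fun δ f hf => ⟨_, han,
    eventually_eq_profileOfThirdDeriv hy₀ hC hr hw hfix hf⟩⟩
  · obtain ⟨g₁, g₂, h₁, h₂, h₃, hJ, hg₁⟩ := hasDerivAt_of_profileMap_fixedPoint hC hr hw hfix hreal
    have hmem : ∀ y ∈ Ioo (y₀ - r) y₀, y₀ - y ∈ Ioo 0 r := fun y hy =>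
      ⟨by linarith [hy.2], by linarith [hy.1]⟩
    have hd₁ : ∀ y ∈ Ioo (y₀ - r) y₀,
        HasDerivAt (profileOfThirdDeriv y₀ C w) (g₁ (y₀ - y)) y := fun y hy =>
      (((h₁ _ (hmem y hy)).comp_const_sub y₀ y).const_sub 1).congr_deriv (neg_neg _)
    have hd₃ : EqOn (iteratedDeriv 3 (profileOfThirdDeriv y₀ C w))
        (fun y => (w ((y₀ - y : ℝ) : ℂ)).re) (Ioo (y₀ - r) y₀) :=
      iteratedDeriv_three_eq isOpen_Ioo hd₁
        (fun y hy => (h₂ _ (hmem y hy)).comp_const_sub y₀ y)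
        (fun y hy => ((h₃ _ (hmem y hy)).comp_const_sub y₀ y).neg.congr_deriv (neg_neg _))
    have hflux : ∀ y ∈ Ioo (y₀ - r) y₀,
        HasDerivAt (thinFilmFlux (profileOfThirdDeriv y₀ C w)) (y * g₁ (y₀ - y) / 4) y := by
      intro y hy
      refine (((hJ _ (hmem y hy)).comp_const_sub y₀ y).congr_deriv (by ring)).congr_of_eventuallyEq
        ?_
      filter_upwards [isOpen_Ioo.mem_nhds hy] with x hx
      rw [thinFilmFlux, hd₃ hx, profileOfThirdDeriv]
      ring
    have hleft : Ioo (y₀ - r) y₀ ∈ 𝓝[<] y₀ := Ioo_mem_nhdsLT (by linarith)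
    have hexp := (profileOfThirdDeriv_expansion hr hdiff hfix).mono
      (nhdsWithin_le_nhds (s := Iio y₀))
    have hwle : ∀ y ∈ Ioo (y₀ - r) y₀, |(w ((y₀ - y : ℝ) : ℂ)).re| ≤ y₀ + 4 := fun y hy =>
      (Complex.abs_re_le_norm _).trans (hw.segment.bound _ ⟨_, hmem y hy, rfl⟩)
    refine ⟨⟨hr0, ⟨fun y hy => ?_, fun y hy => ?_, fun y hy => (hflux y hy).differentiableAt,
      fun y hy => ?_⟩, ?_⟩, ?_, ?_, ?_, hexp⟩
    · have ht := hmem y hy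
      exact (analyticAt_profileOfThirdDeriv hdiff
        (by rw [abs_of_pos ht.1]; exact ht.2)).contDiffAt.contDiffWithinAt
    · have ht := hmem y hy
      obtain ⟨-, hl, hu⟩ := quotientOfThirdDeriv_bounds hr hw hreal ht
      rw [profileOfThirdDeriv, ← Complex.ofReal_pow, Complex.re_ofReal_mul]
      have h2 : 0 < (y₀ - y) ^ 2 := pow_pos ht.1 2
      have h3 : (y₀ - y) ^ 2 ≤ r := by nlinarith [ht.1, ht.2, hr.le_one]
      have h4 : 0 < (y₀ - y) ^ 2 * (quotientOfThirdDeriv C w ((y₀ - y : ℝ) : ℂ)).re :=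
        mul_pos h2 (by linarith)
      have h5 : (y₀ - y) ^ 2 * (quotientOfThirdDeriv C w ((y₀ - y : ℝ) : ℂ)).re ≤ 1 :=
        (mul_le_mul h3 hu (by linarith) hr0.le).trans hr.mul_C_le
      constructor <;> linarith
    · rw [(hflux y hy).deriv, (hd₁ y hy).deriv]
      ring
    · have h4 : (fun y : ℝ => (y₀ - y) ^ 4) =O[𝓝[<] y₀] fun y => (y₀ - y) ^ 3 := by
        refine IsBigO.of_bound 1 ?_
        filter_upwards [hleft] with y hy
        have ht := hmem y hy
        rw [one_mul, norm_pow, norm_pow, Real.norm_eq_abs, abs_of_pos ht.1]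
        exact pow_le_pow_of_le_one ht.1.le (ht.2.le.trans hr.le_one) (by norm_num)
      have h3 := (isBigO_refl (fun y : ℝ => (y₀ - y) ^ 3) (𝓝[<] y₀)).const_mul_left (y₀ / 48)
      refine ((hexp.trans h4).add h3).congr_left fun y => ?_
      ring
    · refine strictMonoOn_of_deriv_pos (convex_Ioo _ _)
        (fun y hy => (hd₁ y hy).continuousAt.continuousWithinAt) fun y hy => ?_
      rw [interior_Ioo] at hy
      rw [(hd₁ y hy).deriv]
      have ht := hmem y hy
      -- With `t = y₀ - y`, `g₁ t ≥ 2 C t - (y₀ + 4) t² ≥ 3 C t / 2 > 0`.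
      have h1 := (abs_le.1 (hg₁ _ ht)).1
      have h2 : (y₀ + 4) * (y₀ - y) ≤ C / 2 := by
        refine le_trans ?_ hr.mul_le
        rw [mul_comm]
        exact mul_le_mul_of_nonneg_right ht.2.le (by linarith)
      nlinarith [mul_le_mul_of_nonneg_right h2 ht.1.le, mul_pos hC ht.1]
    · have hlim : Tendsto (fun y => 2 * C * (y₀ - y) + (y₀ + 4) * (y₀ - y) ^ 2) (𝓝[<] y₀)
          (𝓝 0) := by
        have : Continuous fun y => 2 * C * (y₀ - y) + (y₀ + 4) * (y₀ - y) ^ 2 := by fun_prop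
        simpa using (this.tendsto y₀).mono_left nhdsWithin_le_nhds
      refine squeeze_zero_norm' ?_ hlim
      filter_upwards [hleft] with y hy
      rw [(hd₁ y hy).deriv, Real.norm_eq_abs]
      have ht := hmem y hy
      have h1 := abs_le.1 (hg₁ _ ht)
      have h2 := mul_pos hC ht.1
      exact abs_le.2 ⟨by linarith [h1.1], by linarith [h1.2]⟩
    · have hF : profileOfThirdDeriv y₀ C w y₀ = 1 := by simp [profileOfThirdDeriv]
      have hlim : Tendsto (fun y => |1 - profileOfThirdDeriv y₀ C w y ^ 2| * (y₀ + 4)) (𝓝[<] y₀)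
          (𝓝 0) := by
        have := ((continuousAt_const.sub (han.continuousAt.pow 2)).abs.mul
          (continuousAt_const (y := y₀ + 4)) :
          ContinuousAt (fun y => |1 - profileOfThirdDeriv y₀ C w y ^ 2| * (y₀ + 4)) y₀)
        have h2 : Tendsto (fun y => |1 - profileOfThirdDeriv y₀ C w y ^ 2| * (y₀ + 4)) (𝓝[<] y₀)
            (𝓝 (|1 - profileOfThirdDeriv y₀ C w y₀ ^ 2| * (y₀ + 4))) :=
          this.tendsto.mono_left nhdsWithin_le_nhds
        rw [hF] at h2
        simpa using h2
      refine squeeze_zero_norm' ?_ hlim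
      filter_upwards [hleft] with y hy
      rw [thinFilmFlux, hd₃ hy, norm_mul]
      exact mul_le_mul_of_nonneg_left (hwle y hy) (abs_nonneg _)
  · intro δ₁ δ₂ f₁ f₂ hf₁ hf₂
    filter_upwards [eventually_eq_profileOfThirdDeriv hy₀ hC hr hw hfix hf₁,
      eventually_eq_profileOfThirdDeriv hy₀ hC hr hw hfix hf₂] with y e₁ e₂
    rw [e₁, e₂]
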